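/- Let $d$ be a natural number and let $\mathsf X$ be a finite set (the alphabet) with the discrete topology. Let $\mathbb Z^d$ act on $\mathsf X^{\mathbb Z^d}$ (with the product topology) by $(g\cdot w)(h)=w(h-g)$. Let $\mathbb Z^d$ act minimally and faithfully by homeomorphisms on a Cantor set $Y$, and suppose that this action is conjugate, by a $\mathbb Z^d$-equivariant homeomorphism $\varphi\colon Y\to\mathbf C$, to the action on a closed $\mathbb Z^d$-invariant subset $\mathbf C\subset\mathsf X^{\mathbb Z^d}$. Let $[[\mathbb Z^d]]$ be the topological full group of the action, i.e., the group of all homeomorphisms $f$ of $Y$ for which there is a finite partition of $Y$ into clopen sets on each of which $f$ coincides with an element of $\mathbb Z^d$. Then the commutator subgroup $[[\mathbb Z^d]]'$ is finitely generated. An explicit finite generating set is the following. If $U\subset Y$ is clopen and $g_1,g_2,g_3\in\mathbb Z^d$ are such that $g_1(U),g_2(U),g_3(U)$ are pairwise disjoint, let $T_{U,(g_1,g_2,g_3)}\in[[\mathbb Z^d]]$ be the element that acts as $g_2-g_1$ on $g_1(U)$, as $g_3-g_2$ on $g_2(U)$, as $g_1-g_3$ on $g_3(U)$, and as the identity elsewhere.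 Let $B(R)$ be the ball of radius $R$ with center $0$ in $\mathbb Z^d$ for the $\ell^1$ metric. For $w\in\mathbf C$ let $\mathcal W_{w,R}=\{y\in Y:\varphi(y)|_{B(R)}=w|_{B(R)}\}$, and let $\mathcal T_R$ be the set of all elements $T_{\mathcal W_{w,R},(0,e_i,-e_i)}$ with $w\in\mathbf C$ and $1\le i\le d$ such that the three translates are pairwise disjoint, where $e_1,\dots,e_d$ is the standard basis of $\mathbb Z^d$. There exists a natural number $R_1$ such that $(*)$ for every $w\in\mathbf C$ and every non-zero $g\in\mathbb Z^d$ of $\ell^1$-length at most $3$ there is no $u\in\mathbf C$ with both $u|_{B(R_1)}=w|_{B(R_1)}$ and $u|_{B(R_1)+g}=(g\cdot w)|_{B(R_1)+g}$. For every natural number $R_1$ satisfying $(*)$, the sets $\mathcal W_{w,R_1+2}$, $e_i(\mathcal W_{w,R_1+2})$, $-e_i(\mathcal W_{w,R_1+2})$ are pairwise disjoint for all $w\in\mathbf C$ and all $i$, and the set $\mathcal T_{R_1+2}$ is finite and generates $[[\mathbb Z^d]]'$. -/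

import Mathlib

namespace TopFull

open SymbolicDynamics.FullShift
open scoped Pointwise

section FullGroup

variable (G : Type*) (Y : Type*) [AddGroup G] [TopologicalSpace Y] [AddAction G Y]

/-- The topological full group of an action of a discrete group `G` on `Y`: the homeomorphisms `f`
of `Y` that act locally as elements of `G`, that is, `f y = c y +ᵥ y` for a locally constant
function `c : Y → G`. (If `Y` is compact, then `c` is locally constant if and only if there is a
finite partition of `Y` into clopen sets on each of which `f` acts as one element of `G`.) -/
def topFullGroup : Subgroup (Y ≃ₜ Y) where
  carrier := {f | ∃ c : Y → G, IsLocallyConstant c ∧ ∀ y, f y = c y +ᵥ y}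
  one_mem' := ⟨fun _ => 0, IsLocallyConstant.const 0, fun y => by simp⟩
  mul_mem' := by
    rintro f g ⟨c, hc, hf⟩ ⟨e, he, hg⟩
    refine ⟨fun y => c (g y) + e y, (hc.comp_continuous g.continuous).add he, fun y => ?_⟩
    rw [Homeomorph.mul_apply, hf (g y), add_vadd, ← hg y]
  inv_mem' := by
    rintro f ⟨c, hc, hf⟩
    refine ⟨fun y => -c (f⁻¹ y), (hc.comp_continuous (f⁻¹ : Y ≃ₜ Y).continuous).neg, fun y => ?_⟩
    have h : f (f⁻¹ y) = y := f.apply_symm_apply y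
    have h2 := hf (f⁻¹ y)
    rw [h] at h2
    rw [eq_neg_vadd_iff, ← h2]

end FullGroup

section ThreeCycle

variable {G : Type*} {Y : Type*} [AddGroup G] [AddAction G Y]

/-- The translates `g₁(U)`, `g₂(U)`, `g₃(U)` are pairwise disjoint. -/
def DisjointTranslates (U : Set Y) (g₁ g₂ g₃ : G) : Prop :=
  Disjoint (g₁ +ᵥ U) (g₂ +ᵥ U) ∧ Disjoint (g₂ +ᵥ U) (g₃ +ᵥ U) ∧ Disjoint (g₁ +ᵥ U) (g₃ +ᵥ U)

open Classical in
/-- The group element by which `T_{U,(g₁,g₂,g₃)}` moves the point `y`. -/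
noncomputable def cycleCocycle (U : Set Y) (g₁ g₂ g₃ : G) (y : Y) : G :=
  if y ∈ g₁ +ᵥ U then g₂ - g₁
  else if y ∈ g₂ +ᵥ U then g₃ - g₂
  else if y ∈ g₃ +ᵥ U then g₁ - g₃
  else 0

/-- The map `T_{U,(g₁,g₂,g₃)}`, which permutes `g₁(U) → g₂(U) → g₃(U) → g₁(U)` and fixes all the
other points. -/
noncomputable def cycleFun (U : Set Y) (g₁ g₂ g₃ : G) (y : Y) : Y :=
  cycleCocycle U g₁ g₂ g₃ y +ᵥ y

lemma cycleFun_fst {U : Set Y} {g₁ g₂ g₃ : G} {u : Y} (hu : u ∈ U) :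
    cycleFun U g₁ g₂ g₃ (g₁ +ᵥ u) = g₂ +ᵥ u := by
  have h1 : g₁ +ᵥ u ∈ g₁ +ᵥ U := Set.vadd_mem_vadd_set hu
  simp [cycleFun, cycleCocycle, if_pos h1, vadd_vadd]

lemma cycleFun_snd {U : Set Y} {g₁ g₂ g₃ : G} (h : DisjointTranslates U g₁ g₂ g₃) {u : Y}
    (hu : u ∈ U) : cycleFun U g₁ g₂ g₃ (g₂ +ᵥ u) = g₃ +ᵥ u := by
  have h2 : g₂ +ᵥ u ∈ g₂ +ᵥ U := Set.vadd_mem_vadd_set hu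
  have h1 : g₂ +ᵥ u ∉ g₁ +ᵥ U := fun h' => Set.disjoint_left.1 h.1 h' h2
  simp [cycleFun, cycleCocycle, if_pos h2, if_neg h1, vadd_vadd]

lemma cycleFun_trd {U : Set Y} {g₁ g₂ g₃ : G} (h : DisjointTranslates U g₁ g₂ g₃) {u : Y}
    (hu : u ∈ U) : cycleFun U g₁ g₂ g₃ (g₃ +ᵥ u) = g₁ +ᵥ u := by
  have h3 : g₃ +ᵥ u ∈ g₃ +ᵥ U := Set.vadd_mem_vadd_set hu
  have h1 : g₃ +ᵥ u ∉ g₁ +ᵥ U := fun h' => Set.disjoint_left.1 h.2.2 h' h3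
  have h2 : g₃ +ᵥ u ∉ g₂ +ᵥ U := fun h' => Set.disjoint_left.1 h.2.1 h' h3
  simp [cycleFun, cycleCocycle, if_pos h3, if_neg h1, if_neg h2, vadd_vadd]

lemma cycleFun_of_notMem {U : Set Y} {g₁ g₂ g₃ : G} {y : Y} (h1 : y ∉ g₁ +ᵥ U)
    (h2 : y ∉ g₂ +ᵥ U) (h3 : y ∉ g₃ +ᵥ U) : cycleFun U g₁ g₂ g₃ y = y := by
  simp [cycleFun, cycleCocycle, if_neg h1, if_neg h2, if_neg h3]

lemma DisjointTranslates.reverse {U : Set Y} {g₁ g₂ g₃ : G} (h : DisjointTranslates U g₁ g₂ g₃) :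
    DisjointTranslates U g₃ g₂ g₁ :=
  ⟨h.2.1.symm, h.1.symm, h.2.2.symm⟩

lemma cycleFun_reverse {U : Set Y} {g₁ g₂ g₃ : G} (h : DisjointTranslates U g₁ g₂ g₃) (y : Y) :
    cycleFun U g₃ g₂ g₁ (cycleFun U g₁ g₂ g₃ y) = y := by
  by_cases h1 : y ∈ g₁ +ᵥ U
  · obtain ⟨u, hu, rfl⟩ := h1
    change cycleFun U g₃ g₂ g₁ (cycleFun U g₁ g₂ g₃ (g₁ +ᵥ u)) = g₁ +ᵥ u
    rw [cycleFun_fst hu, cycleFun_snd h.reverse hu]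
  by_cases h2 : y ∈ g₂ +ᵥ U
  · obtain ⟨u, hu, rfl⟩ := h2
    change cycleFun U g₃ g₂ g₁ (cycleFun U g₁ g₂ g₃ (g₂ +ᵥ u)) = g₂ +ᵥ u
    rw [cycleFun_snd h hu, cycleFun_fst hu]
  by_cases h3 : y ∈ g₃ +ᵥ U
  · obtain ⟨u, hu, rfl⟩ := h3
    change cycleFun U g₃ g₂ g₁ (cycleFun U g₁ g₂ g₃ (g₃ +ᵥ u)) = g₃ +ᵥ u
    rw [cycleFun_trd h hu, cycleFun_trd h.reverse hu]
  rw [cycleFun_of_notMem h1 h2 h3, cycleFun_of_notMem h3 h2 h1]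

variable [TopologicalSpace Y] [ContinuousConstVAdd G Y]

lemma isClopen_translate {U : Set Y} (hU : IsClopen U) (g : G) : IsClopen (g +ᵥ U) :=
  ⟨hU.1.vadd g, hU.2.vadd g⟩

lemma isLocallyConstant_cycleCocycle {U : Set Y} (hU : IsClopen U) (g₁ g₂ g₃ : G) :
    IsLocallyConstant (cycleCocycle U g₁ g₂ g₃) := by
  classical
  have key : ∀ (A : Set Y) (_ : IsClopen A) (f g : Y → G), IsLocallyConstant f →
      IsLocallyConstant g → IsLocallyConstant (fun y => if y ∈ A then f y else g y) := by
    intro A hA f g hf hg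
    rw [IsLocallyConstant.iff_eventually_eq] at *
    intro x
    by_cases hx : x ∈ A
    · filter_upwards [hA.2.mem_nhds hx, hf x] with y hy hfy
      simp [hx, hy, hfy]
    · filter_upwards [hA.1.isOpen_compl.mem_nhds hx, hg x] with y hy hgy
      have hy' : y ∉ A := hy
      simp [hx, hy', hgy]
  unfold cycleCocycle
  convert key _ (isClopen_translate hU g₁) _ _ (IsLocallyConstant.const (g₂ - g₁))
    (key _ (isClopen_translate hU g₂) _ _ (IsLocallyConstant.const (g₃ - g₂))
      (key _ (isClopen_translate hU g₃) _ _ (IsLocallyConstant.const (g₁ - g₃))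
        (IsLocallyConstant.const 0))) using 1
  funext y
  simp

lemma continuous_cycleFun {U : Set Y} (hU : IsClopen U) (g₁ g₂ g₃ : G) :
    Continuous (cycleFun U g₁ g₂ g₃) := by
  rw [continuous_iff_continuousAt]
  intro x
  have h := (IsLocallyConstant.iff_eventually_eq _).1
    (isLocallyConstant_cycleCocycle hU g₁ g₂ g₃) x
  refine (continuous_const_vadd (cycleCocycle U g₁ g₂ g₃ x)).continuousAt.congr ?_
  filter_upwards [h] with y hy
  simp only [cycleFun]
  rw [hy]

/-- The element `T_{U,(g₁,g₂,g₃)}` of the topological full group, for a clopen set `U` such that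
`g₁(U)`, `g₂(U)`, `g₃(U)` are pairwise disjoint. -/
noncomputable def threeCycle (U : Set Y) (g₁ g₂ g₃ : G) (hU : IsClopen U)
    (h : DisjointTranslates U g₁ g₂ g₃) : topFullGroup G Y :=
  ⟨{ toFun := cycleFun U g₁ g₂ g₃
     invFun := cycleFun U g₃ g₂ g₁
     left_inv := cycleFun_reverse h
     right_inv := cycleFun_reverse h.reverse
     continuous_toFun := continuous_cycleFun hU g₁ g₂ g₃
     continuous_invFun := continuous_cycleFun hU g₃ g₂ g₁ },
    cycleCocycle U g₁ g₂ g₃, isLocallyConstant_cycleCocycle hU g₁ g₂ g₃, fun _ => rfl⟩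

end ThreeCycle

section Subshift

variable {d : ℕ} {X : Type*}

/-- The action of `g ∈ ℤ^d` on `X^(ℤ^d)`. -/
def translate (g : Fin d → ℤ) (w : (Fin d → ℤ) → X) : (Fin d → ℤ) → X :=
  fun h => w (h - g)

/-- The word length on `ℤ^d` with respect to the standard generators, that is, the `ℓ¹` norm. -/
def len (g : Fin d → ℤ) : ℕ := ∑ i, (g i).natAbs

variable (d) in
/-- The ball of radius `R` around `0` in `ℤ^d`, for the `ℓ¹` metric. -/
noncomputable def ball (R : ℕ) : Finset (Fin d → ℤ) :=
  (Fintype.piFinset fun _ => Finset.Icc (-(R : ℤ)) (R : ℤ)).filter fun g => len g ≤ R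

lemma mem_ball {R : ℕ} {g : Fin d → ℤ} : g ∈ ball d R ↔ len g ≤ R := by
  simp only [ball, Finset.mem_filter, Fintype.mem_piFinset, Finset.mem_Icc, and_iff_right_iff_imp]
  intro h i
  have h1 : (g i).natAbs ≤ len g :=
    Finset.single_le_sum (f := fun i => (g i).natAbs) (fun _ _ => Nat.zero_le _)
      (Finset.mem_univ i)
  omega

variable [TopologicalSpace X]

/-- For every `w` in the subshift `C`, the patch `π = (B(R), w|_{B(R)})` and its translate `π + g`
are incompatible (no sequence in `C` contains both) whenever `g ≠ 0` has length at most `3`.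
The set of all sequences containing the patch `(B, w|_B)` is `cylinder B w`, and `π + g` is the
patch of `g(w)` with support `B(R) + g`. -/
def IsSeparatingRadius (C : Subshift X (Fin d → ℤ)) (R : ℕ) : Prop :=
  ∀ w ∈ C.carrier, ∀ g : Fin d → ℤ, g ≠ 0 → len g ≤ 3 →
    ¬ ∃ u ∈ C.carrier, u ∈ cylinder (ball d R) w ∧
      u ∈ cylinder ((ball d R).image fun h => h + g) (translate g w)

variable {Y : Type*} [TopologicalSpace Y]

/-- The subset of `Y` that corresponds to the cylindrical set of the patch `(B, w|_B)` in the
subshift `C` under a homeomorphism `φ` from `Y` to `C`. -/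
def patchSet {C : Subshift X (Fin d → ℤ)} (φ : Y ≃ₜ C.carrier) (B : Finset (Fin d → ℤ))
    (w : (Fin d → ℤ) → X) : Set Y :=
  {y | (φ y : (Fin d → ℤ) → X) ∈ cylinder B w}

lemma isClopen_patchSet [DiscreteTopology X] {C : Subshift X (Fin d → ℤ)} (φ : Y ≃ₜ C.carrier)
    (B : Finset (Fin d → ℤ)) (w : (Fin d → ℤ) → X) : IsClopen (patchSet φ B w) :=
  (IsClopen.preimage ⟨isClosed_cylinder B w, isOpen_cylinder B w⟩
    (continuous_subtype_val.comp φ.continuous) :)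

/-- The set `𝒯_R` of all elements `T_{π,(0,eᵢ,-eᵢ)}` of the topological full group, where `π` runs
through the patches `(B(R), w|_{B(R)})` with `w ∈ C`, and `i` through the coordinates. -/
def cycleSet [DiscreteTopology X] [AddAction (Fin d → ℤ) Y] [ContinuousConstVAdd (Fin d → ℤ) Y]
    {C : Subshift X (Fin d → ℤ)} (φ : Y ≃ₜ C.carrier) (R : ℕ) :
    Set (topFullGroup (Fin d → ℤ) Y) :=
  {T | ∃ w ∈ C.carrier, ∃ i : Fin d,
    ∃ h : DisjointTranslates (patchSet φ (ball d R) w) (0 : Fin d → ℤ) (Pi.single i 1)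
        (-Pi.single i 1),
      T = threeCycle (patchSet φ (ball d R) w) 0 (Pi.single i 1) (-Pi.single i 1)
        (isClopen_patchSet φ (ball d R) w) h}

end Subshift

end TopFull

/-! Let A be the group generated by all three-cycles (`alternatingFullGroup`). The theorem splits
into two equalities: the commutator subgroup is A, and A is generated by the three-cycles of the
given finite set. The action is free, because the group is abelian and acts minimally and faithfully
(`free_of_minimal_of_faithful`).

A lies in the commutator subgroup since a three-cycle is a commutator in the symmetric group on
three levels. For the converse (`commutator_le_alternatingFullGroup`) one shows that the quotient by
A is abelian. Let S be the group generated by exchanges of two disjoint translates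
(`swapFullGroup`). Modulo A, a small exchange equals an exchange supported in any prescribed
non-empty open set, so S commutes modulo A with every element that fixes a non-empty open set
pointwise, and with itself. Multiplication by S makes the density of the support of a given element
as small as desired (`exists_smallDensity`), and a counting argument in cubes of ℤ^d gives an
element of S that moves one small clopen set off another (`exists_swapFullGroup_disjoint`). Hence
any two elements become, up to S and A, elements with disjoint supports, which commute.

For the second equality there are two rules: (a b c) and (a b d) over one base give (a c d)
(`CycMem.share_two`), and the commutator of (a b c) over P with (a d e) over Q is a three-cycle over
P ∩ Q when the other levels do not meet (`CycMem.inter`). A patch of radius R + 1 is an intersection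
of patches of radius R around neighbouring centres, so the second rule raises the radius from R₁ + 2
to every larger one (`cycMem_patch_of_mem_cycleSet`); condition (*) keeps the levels apart. In
dimension one a single coincidence, at distance 4, is not excluded by (*), and patches of period 4
are obtained as complements. Every clopen set is a finite disjoint union of patches, so all
three-cycles along coordinate directions are generated, and chaining them through ℤ^d gives all
three-cycles (`alternatingFullGroup_le_of_cycMem_single`). -/

set_option linter.unusedSectionVars false

namespace TopFull

open scoped Pointwise
open Equiv commutatorElement SymbolicDynamics.FullShift

/-! ### Towers of disjoint translates and the permutations of their levels. -/

section Tower

variable {G Y ι : Type*} [AddCommGroup G] [AddAction G Y] [TopologicalSpace Y]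

/-- A clopen base `V` whose translates by the group elements `g i` are pairwise disjoint. -/
structure IsTower (g : ι → G) (V : Set Y) : Prop where
  clopen : IsClopen V
  index_eq : ∀ i j, ∀ u ∈ V, ∀ v ∈ V, g i +ᵥ u = g j +ᵥ v → i = j

lemma IsTower.mono {g : ι → G} {V W : Set Y} (h : IsTower g V) (hW : IsClopen W) (hWV : W ⊆ V) :
    IsTower g W :=
  ⟨hW, fun _ _ u hu v hv => h.index_eq _ _ u (hWV hu) v (hWV hv)⟩

lemma IsTower.comp {κ : Type*} {g : ι → G} {V : Set Y} (h : IsTower g V) {e : κ → ι}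
    (he : Function.Injective e) : IsTower (g ∘ e) V :=
  ⟨h.clopen, fun _ _ u hu v hv huv => he (h.index_eq _ _ u hu v hv huv)⟩

open Classical in
/-- The permutation of the levels `g i +ᵥ V` of a tower induced by a permutation of the indices,
as a map on the whole space. -/
noncomputable def towerMap (g : ι → G) (V : Set Y) (σ : Perm ι) (y : Y) : Y :=
  if h : ∃ i, y ∈ g i +ᵥ V then (g (σ h.choose) - g h.choose) +ᵥ y else y

lemma towerMap_vadd {g : ι → G} {V : Set Y} (h : IsTower g V) (σ : Perm ι) (i : ι) {v : Y}
    (hv : v ∈ V) : towerMap g V σ (g i +ᵥ v) = g (σ i) +ᵥ v := by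
  have hex : ∃ j, g i +ᵥ v ∈ g j +ᵥ V := ⟨i, Set.vadd_mem_vadd_set hv⟩
  have hi : hex.choose = i := by
    obtain ⟨u, hu, huv⟩ := hex.choose_spec
    exact h.index_eq _ _ u hu v hv huv
  rw [towerMap, dif_pos hex, hi, vadd_vadd, sub_add_cancel]

lemma towerMap_of_notMem {g : ι → G} {V : Set Y} (σ : Perm ι) {y : Y}
    (hy : ∀ i, y ∉ g i +ᵥ V) : towerMap g V σ y = y :=
  dif_neg fun ⟨i, hi⟩ => hy i hi

lemma towerMap_mul {g : ι → G} {V : Set Y} (h : IsTower g V) (σ τ : Perm ι) (y : Y) :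
    towerMap g V (σ * τ) y = towerMap g V σ (towerMap g V τ y) := by
  by_cases hy : ∃ i, y ∈ g i +ᵥ V
  · obtain ⟨i, v, hv, rfl⟩ := hy
    change towerMap g V (σ * τ) (g i +ᵥ v) = towerMap g V σ (towerMap g V τ (g i +ᵥ v))
    simp only [towerMap_vadd h _ _ hv, Perm.mul_apply]
  · push Not at hy
    simp only [towerMap_of_notMem _ hy]

lemma towerMap_one {g : ι → G} {V : Set Y} (y : Y) : towerMap g V 1 y = y := by
  unfold towerMap
  split_ifs <;> simp

variable [ContinuousConstVAdd G Y] [Finite ι]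

lemma towerMap_cocycle {g : ι → G} {V : Set Y} (h : IsTower g V) (σ : Perm ι) :
    ∃ c : Y → G, IsLocallyConstant c ∧ ∀ y, towerMap g V σ y = c y +ᵥ y := by
  classical
  refine ⟨fun y => if h : ∃ i, y ∈ g i +ᵥ V then g (σ h.choose) - g h.choose else 0, ?_, ?_⟩
  · rw [IsLocallyConstant.iff_eventually_eq]
    intro y
    have key : ∀ i, ∀ z ∈ g i +ᵥ V, ∀ hex : ∃ j, z ∈ g j +ᵥ V, hex.choose = i := by
      rintro i z ⟨v, hv, rfl⟩ hex
      obtain ⟨u, hu, huv⟩ := hex.choose_spec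
      exact h.index_eq _ _ u hu v hv huv
    by_cases hy : ∃ i, y ∈ g i +ᵥ V
    · obtain ⟨i, hi⟩ := hy
      filter_upwards [(isClopen_translate h.clopen (g i)).2.mem_nhds hi] with z hz
      rw [dif_pos ⟨i, hz⟩, dif_pos ⟨i, hi⟩, key i z hz, key i y hi]
    · have : IsOpen (⋃ i, g i +ᵥ V)ᶜ :=
        (isClosed_iUnion_of_finite fun i => (isClopen_translate h.clopen (g i)).1).isOpen_compl
      filter_upwards [this.mem_nhds (by simpa using hy)] with z hz
      rw [dif_neg hy, dif_neg (by simpa using hz)]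
  · intro y
    by_cases h : ∃ i, y ∈ g i +ᵥ V
    · simp only [towerMap, dif_pos h]
    · simp only [towerMap, dif_neg h, zero_vadd]

lemma continuous_of_cocycle {f : Y → Y} {c : Y → G} (hc : IsLocallyConstant c)
    (hf : ∀ y, f y = c y +ᵥ y) : Continuous f := by
  rw [continuous_iff_continuousAt]
  intro x
  refine (continuous_const_vadd (c x)).continuousAt.congr ?_
  filter_upwards [(IsLocallyConstant.iff_eventually_eq _).1 hc x] with y hy
  rw [hf, hy]

lemma continuous_towerMap {g : ι → G} {V : Set Y} (h : IsTower g V) (σ : Perm ι) :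
    Continuous (towerMap g V σ) := by
  obtain ⟨c, hc, hf⟩ := towerMap_cocycle h σ
  exact continuous_of_cocycle hc hf

lemma topFullGroup_ext {f g : topFullGroup G Y} (h : ∀ y, f.1 y = g.1 y) : f = g :=
  Subtype.ext (Homeomorph.ext h)

/-- The representation of the symmetric group of the index set of a tower by elements of the
topological full group that permute the levels of the tower. -/
noncomputable def tower {g : ι → G} {V : Set Y} (h : IsTower g V) :
    Perm ι →* topFullGroup G Y where
  toFun σ := ⟨{ toFun := towerMap g V σ
                invFun := towerMap g V σ⁻¹
                left_inv := fun y => by rw [← towerMap_mul h, inv_mul_cancel, towerMap_one]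
                right_inv := fun y => by rw [← towerMap_mul h, mul_inv_cancel, towerMap_one]
                continuous_toFun := continuous_towerMap h σ
                continuous_invFun := continuous_towerMap h σ⁻¹ }, towerMap_cocycle h σ⟩
  map_one' := topFullGroup_ext fun y => towerMap_one y
  map_mul' σ τ := topFullGroup_ext fun y => towerMap_mul h σ τ y

lemma tower_vadd {g : ι → G} {V : Set Y} (h : IsTower g V) (σ : Perm ι) (i : ι) {v : Y}
    (hv : v ∈ V) : (tower h σ).1 (g i +ᵥ v) = g (σ i) +ᵥ v :=
  towerMap_vadd h σ i hv

lemma tower_of_notMem {g : ι → G} {V : Set Y} (h : IsTower g V) (σ : Perm ι) {y : Y}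
    (hy : ∀ i, y ∉ g i +ᵥ V) : (tower h σ).1 y = y :=
  towerMap_of_notMem σ hy

lemma eq_tower_iff {g : ι → G} {V : Set Y} (h : IsTower g V) (σ : Perm ι) (f : topFullGroup G Y) :
    f = tower h σ ↔ (∀ i, ∀ v ∈ V, f.1 (g i +ᵥ v) = g (σ i) +ᵥ v) ∧
      ∀ y, (∀ i, y ∉ g i +ᵥ V) → f.1 y = y := by
  constructor
  · rintro rfl
    exact ⟨fun i v hv => tower_vadd h σ i hv, fun y hy => tower_of_notMem h σ hy⟩
  · rintro ⟨h1, h2⟩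
    refine topFullGroup_ext fun y => ?_
    by_cases hy : ∃ i, y ∈ g i +ᵥ V
    · obtain ⟨i, v, hv, rfl⟩ := hy
      exact (h1 i v hv).trans (tower_vadd h σ i hv).symm
    · push Not at hy
      rw [h2 y hy, tower_of_notMem h σ hy]

lemma tower_fixed_index {g : ι → G} {V : Set Y} (h : IsTower g V) {σ : Perm ι} {y : Y}
    (hy : ∀ i, σ i ≠ i → y ∉ g i +ᵥ V) : (tower h σ).1 y = y := by
  by_cases hy' : ∃ i, y ∈ g i +ᵥ V
  · obtain ⟨i, v, hv, rfl⟩ := hy'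
    have hi : σ i = i := by
      by_contra hne
      exact hy i hne (Set.vadd_mem_vadd_set hv)
    exact (tower_vadd h σ i hv).trans (by rw [hi])
  · push Not at hy'
    exact tower_of_notMem h σ hy'

/-- Disjoint bases give disjoint towers. This additivity in the base is what allows three-cycles to
be cut into arbitrarily small pieces. -/
lemma tower_union {g : ι → G} {V W : Set Y} (hVW : IsTower g (V ∪ W)) (hV : IsTower g V)
    (hW : IsTower g W) (hd : Disjoint V W) (σ : Perm ι) :
    tower hVW σ = tower hV σ * tower hW σ := by
  symm
  rw [eq_tower_iff]
  have aux : ∀ {V W : Set Y}, IsTower g (V ∪ W) → Disjoint V W → ∀ i, ∀ v ∈ V, ∀ j,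
      g i +ᵥ v ∉ g j +ᵥ W := by
    rintro V W h hd i v hv j ⟨w, hw, hwv⟩
    have hij := h.index_eq j i w (Or.inr hw) v (Or.inl hv) hwv
    subst hij
    have : w = v := AddAction.injective _ hwv
    subst this
    exact Set.disjoint_left.1 hd hv hw
  constructor
  · rintro i v (hv | hv)
    · change (tower hV σ).1 ((tower hW σ).1 _) = _
      rw [tower_of_notMem hW σ (aux hVW hd i v hv), tower_vadd hV σ i hv]
    · change (tower hV σ).1 ((tower hW σ).1 _) = _
      rw [tower_vadd hW σ i hv]
      rw [Set.union_comm] at hVW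
      exact tower_of_notMem hV σ (aux hVW hd.symm _ v hv)
  · intro y hy
    change (tower hV σ).1 ((tower hW σ).1 _) = _
    rw [tower_of_notMem hW σ fun i hi => hy i (Set.vadd_set_mono Set.subset_union_right hi),
      tower_of_notMem hV σ fun i hi => hy i (Set.vadd_set_mono Set.subset_union_left hi)]

lemma tower_congr {g g' : ι → G} {V V' : Set Y} (h : IsTower g V) (h' : IsTower g' V')
    (hg : g = g') (hV : V = V') (σ : Perm ι) : tower h σ = tower h' σ := by
  subst hg hV
  rfl

lemma tower_empty {g : ι → G} (h : IsTower g (∅ : Set Y)) (σ : Perm ι) : tower h σ = 1 := by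
  symm
  rw [eq_tower_iff]
  exact ⟨fun _ _ hv => hv.elim, fun _ _ => rfl⟩

/-- Conjugating the permutation of a tower by an element that acts on every level as a group
element gives the permutation of the moved tower. -/
lemma conj_tower {g g' : ι → G} {V : Set Y} (h : IsTower g V) (h' : IsTower g' V) (σ : Perm ι)
    (f : topFullGroup G Y) (hf : ∀ i, ∀ v ∈ V, f.1 (g i +ᵥ v) = g' i +ᵥ v) :
    f * tower h σ * f⁻¹ = tower h' σ := by
  rw [mul_inv_eq_iff_eq_mul]
  refine topFullGroup_ext fun y => ?_
  change f.1 ((tower h σ).1 y) = (tower h' σ).1 (f.1 y)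
  by_cases hy : ∃ i, y ∈ g i +ᵥ V
  · obtain ⟨i, v, hv, rfl⟩ := hy
    change f.1 ((tower h σ).1 (g i +ᵥ v)) = (tower h' σ).1 (f.1 (g i +ᵥ v))
    rw [tower_vadd h σ i hv, hf _ v hv, hf _ v hv, tower_vadd h' σ i hv]
  · push Not at hy
    rw [tower_of_notMem h σ hy, tower_of_notMem h' σ]
    rintro i ⟨v, hv, hvy⟩
    refine hy i ⟨v, hv, f.1.injective ?_⟩
    exact (hf i v hv).trans hvy

lemma isTower_of_conj {g g' : ι → G} {V : Set Y} (h : IsTower g V)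
    (f : topFullGroup G Y) (hf : ∀ i, ∀ v ∈ V, f.1 (g i +ᵥ v) = g' i +ᵥ v) : IsTower g' V :=
  ⟨h.clopen, fun i j u hu v hv huv => h.index_eq i j u hu v hv
    (f.1.injective (by rw [hf i u hu, hf j v hv, huv]))⟩

lemma disjointTranslates_of_isTower {g : ι → G} {V : Set Y} (h : IsTower g V) {a b c : ι}
    (hab : a ≠ b) (hbc : b ≠ c) (hac : a ≠ c) : DisjointTranslates V (g a) (g b) (g c) := by
  have key : ∀ i j, i ≠ j → Disjoint (g i +ᵥ V) (g j +ᵥ V) := by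
    intro i j hij
    rw [Set.disjoint_left]
    rintro _ ⟨u, hu, rfl⟩ ⟨v, hv, huv⟩
    exact hij (h.index_eq _ _ u hu v hv huv.symm)
  exact ⟨key _ _ hab, key _ _ hbc, key _ _ hac⟩

lemma isTower_of_disjointTranslates {V : Set Y} (hV : IsClopen V) {a b c : G}
    (h : DisjointTranslates V a b c) : IsTower ![a, b, c] V := by
  refine ⟨hV, fun i j u hu v hv huv => ?_⟩
  obtain ⟨h1, h2, h3⟩ := h
  rw [Set.disjoint_left] at h1 h2 h3
  have m : ∀ (g : G) {x : Y}, x ∈ V → g +ᵥ x ∈ g +ᵥ V := fun g x hx => Set.vadd_mem_vadd_set hx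
  fin_cases i <;> fin_cases j <;> simp at huv ⊢
  · exact h1 (m a hu) (huv ▸ m b hv)
  · exact h3 (m a hu) (huv ▸ m c hv)
  · exact h1 (m a hv) (huv ▸ m b hu)
  · exact h2 (m b hu) (huv ▸ m c hv)
  · exact h3 (m a hv) (huv ▸ m c hu)
  · exact h2 (m b hv) (huv ▸ m c hu)

lemma threeCycle_eq_tower [DecidableEq ι] {g : ι → G} {V : Set Y} (h : IsTower g V) {a b c : ι}
    (hab : a ≠ b) (hbc : b ≠ c) (hac : a ≠ c) (hV : IsClopen V)
    (hd : DisjointTranslates V (g a) (g b) (g c)) :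
    threeCycle V (g a) (g b) (g c) hV hd = tower h (swap a b * swap b c) := by
  rw [eq_tower_iff]
  constructor
  · intro i v hv
    change cycleFun V (g a) (g b) (g c) (g i +ᵥ v) = _
    by_cases hi : i = a
    · subst hi
      rw [cycleFun_fst hv]
      simp [swap_apply_of_ne_of_ne hab hac]
    by_cases hi : i = b
    · subst hi
      rw [cycleFun_snd hd hv]
      simp [swap_apply_of_ne_of_ne hac.symm hbc.symm]
    by_cases hi : i = c
    · subst hi
      rw [cycleFun_trd hd hv]
      simp
    have key : ∀ j, i ≠ j → g i +ᵥ v ∉ g j +ᵥ V := by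
      rintro j hij ⟨u, hu, huv⟩
      exact hij (h.index_eq _ _ u hu v hv huv).symm
    rw [cycleFun_of_notMem (key a ‹_›) (key b ‹_›) (key c ‹_›)]
    simp [swap_apply_of_ne_of_ne, *]
  · intro y hy
    exact cycleFun_of_notMem (hy a) (hy b) (hy c)

end Tower

/-! ### Localisation by compactness, and exchanges modulo three-cycles. -/

section Compact

lemma clopen_induction {Y : Type*} [TopologicalSpace Y] [CompactSpace Y] {U : Set Y}
    (hU : IsClopen U) (P : Set Y → Prop) (empty : P ∅)
    (union : ∀ V W, IsClopen V → IsClopen W → V ⊆ U → W ⊆ U → Disjoint V W → P V → P W →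
      P (V ∪ W))
    (loc : ∀ u ∈ U, ∃ N, IsClopen N ∧ u ∈ N ∧ ∀ V, IsClopen V → V ⊆ N → V ⊆ U → P V) : P U := by
  -- The property is made hereditary for clopen subsets, so that an overlapping union can be cut
  -- into the disjoint pieces `V ∩ s'` and `V \ s'`.
  have key : ∃ s', IsClopen s' ∧ U ⊆ s' ∧ ∀ V, IsClopen V → V ⊆ s' → V ⊆ U → P V := by
    refine hU.1.isCompact.induction_on
      (p := fun s => ∃ s', IsClopen s' ∧ s ⊆ s' ∧ ∀ V, IsClopen V → V ⊆ s' → V ⊆ U → P V)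
      ?_ ?_ ?_ ?_
    · refine ⟨∅, isClopen_empty, subset_rfl, fun V _ hV _ => ?_⟩
      rw [Set.subset_empty_iff.1 hV]
      exact empty
    · rintro s t hst ⟨t', h1, h2, h3⟩
      exact ⟨t', h1, hst.trans h2, h3⟩
    · rintro s t ⟨s', hs1, hs2, hs3⟩ ⟨t', ht1, ht2, ht3⟩
      refine ⟨s' ∪ t', hs1.union ht1, Set.union_subset_union hs2 ht2, fun V hV hVst hVU => ?_⟩
      rw [← Set.inter_union_sdiff V s']
      refine union _ _ (hV.inter hs1) (hV.diff hs1) (Set.inter_subset_left.trans hVU)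
        (Set.sdiff_subset.trans hVU) Set.disjoint_sdiff_inter.symm
        (hs3 _ (hV.inter hs1) Set.inter_subset_right (Set.inter_subset_left.trans hVU))
        (ht3 _ (hV.diff hs1) ?_ (Set.sdiff_subset.trans hVU))
      rintro v ⟨hv, hvs⟩
      exact (hVst hv).resolve_left hvs
    · intro u hu
      obtain ⟨N, hN, huN, hP⟩ := loc u hu
      exact ⟨N, mem_nhdsWithin_of_mem_nhds (hN.2.mem_nhds huN), N, hN, subset_rfl, hP⟩
  obtain ⟨s', -, h1, h2⟩ := key
  exact h2 U hU h1 subset_rfl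

variable {G Y ι : Type*} [AddCommGroup G] [AddAction G Y] [TopologicalSpace Y]
  [ContinuousConstVAdd G Y] [Finite ι]

/-- Towers are additive over disjoint clopen bases, so membership in a subgroup need only be checked
over small bases around each point. -/
lemma tower_mem_of_local [CompactSpace Y] {g : ι → G} {U : Set Y} (h : IsTower g U) (σ : Perm ι)
    (K : Subgroup (topFullGroup G Y))
    (loc : ∀ u ∈ U, ∃ N, IsClopen N ∧ u ∈ N ∧
      ∀ V (hV : IsTower g V), V ⊆ N → V ⊆ U → tower hV σ ∈ K) : tower h σ ∈ K := by
  refine clopen_induction h.clopen (fun V => ∀ hV : IsTower g V, tower hV σ ∈ K) ?_ ?_ ?_ h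
  · intro h
    rw [tower_empty]
    exact K.one_mem
  · intro V W hV hW _ _ hd hPV hPW hVW
    have h1 := hVW.mono hV Set.subset_union_left
    have h2 := hVW.mono hW Set.subset_union_right
    rw [tower_union hVW h1 h2 hd]
    exact K.mul_mem (hPV h1) (hPW h2)
  · intro u hu
    obtain ⟨N, h1, h2, h3⟩ := loc u hu
    exact ⟨N, h1, h2, fun V hV hVN hVU hT => h3 V hT hVN hVU⟩

lemma exists_clopen_forall_apply_eq (f : topFullGroup G Y) (g : ι → G) (u : Y) :
    ∃ g' : ι → G, ∃ N, IsClopen N ∧ u ∈ N ∧ ∀ v ∈ N, ∀ i, f.1 (g i +ᵥ v) = g' i +ᵥ v := by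
  obtain ⟨c, hc, hf⟩ := f.2
  refine ⟨fun i => c (g i +ᵥ u) + g i, ⋂ i, {v | c (g i +ᵥ v) = c (g i +ᵥ u)},
    isClopen_iInter_of_finite fun i => ?_, by simp, fun v hv i => ?_⟩
  · exact (hc.comp_continuous (continuous_const_vadd (g i))).isClopen_fiber _
  · rw [hf, add_vadd]
    congr 1
    exact Set.mem_iInter.1 hv i

/-- Being separated by distinct levels is an open condition on pairs of points. It holds at `(u,
u)`, hence on the square of a clopen neighbourhood of `u`. -/
lemma exists_isTower [CompactSpace Y] [T2Space Y] [TotallyDisconnectedSpace Y]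
    {g : ι → G} {u : Y} (hu : Function.Injective fun i => g i +ᵥ u) :
    ∃ N, u ∈ N ∧ IsTower g N := by
  have h : IsOpen {p : Y × Y | ∀ i j, i ≠ j → g i +ᵥ p.1 ≠ g j +ᵥ p.2} := by
    simp only [Set.ofPred_forall]
    refine isOpen_iInter_of_finite fun i => isOpen_iInter_of_finite fun j =>
      isOpen_iInter_of_finite fun _ => ?_
    exact isOpen_ne_fun (by fun_prop) (by fun_prop)
  have hmem : {p : Y × Y | ∀ i j, i ≠ j → g i +ᵥ p.1 ≠ g j +ᵥ p.2} ∈ nhds (u, u) :=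
    h.mem_nhds fun i j hij he => hij (hu he)
  rw [mem_nhds_prod_iff'] at hmem
  obtain ⟨A, B, hA, huA, hB, huB, hAB⟩ := hmem
  obtain ⟨N, hN, huN, hNAB⟩ := compact_exists_isClopen_in_isOpen (hA.inter hB) ⟨huA, huB⟩
  refine ⟨N, huN, hN, fun i j x hx y hy hxy => ?_⟩
  by_contra hij
  exact hAB (Set.mk_mem_prod (hNAB hx).1 (hNAB hy).2) i j hij hxy

variable (G Y) in
/-- The subgroup generated by all three-cycles. -/
noncomputable def alternatingFullGroup : Subgroup (topFullGroup G Y) :=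
  Subgroup.closure {T | ∃ U a b c, ∃ (hU : IsClopen U) (h : DisjointTranslates U a b c),
    T = threeCycle U a b c hU h}

variable (G Y) in
/-- The subgroup generated by all elements that exchange two disjoint translates of a clopen
set. -/
noncomputable def swapFullGroup : Subgroup (topFullGroup G Y) :=
  Subgroup.closure {T | ∃ (g : Fin 2 → G) (U : Set Y) (h : IsTower g U),
    T = tower h (swap 0 1)}

lemma tower_swap_mul_swap_mem [DecidableEq ι] {g : ι → G} {V : Set Y} (h : IsTower g V)
    {a b c : ι} (hab : a ≠ b) (hbc : b ≠ c) (hac : a ≠ c) :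
    tower h (swap a b * swap b c) ∈ alternatingFullGroup G Y :=
  Subgroup.subset_closure ⟨V, g a, g b, g c, h.clopen, disjointTranslates_of_isTower h hab hbc hac,
    (threeCycle_eq_tower h hab hbc hac _ _).symm⟩

lemma tower_swap_mem [DecidableEq ι] {g : ι → G} {V : Set Y} (h : IsTower g V)
    {a b : ι} (hab : a ≠ b) : tower h (swap a b) ∈ swapFullGroup G Y := by
  have he : Function.Injective ![a, b] := by
    intro i j hij
    fin_cases i <;> fin_cases j <;> simp_all
  refine Subgroup.subset_closure ⟨g ∘ ![a, b], V, h.comp he, ?_⟩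
  symm
  rw [eq_tower_iff]
  constructor
  · intro i v hv
    by_cases hi : i = a
    · subst hi
      simpa using tower_vadd (h.comp he) (swap 0 1) 0 hv
    by_cases hi : i = b
    · subst hi
      simpa using tower_vadd (h.comp he) (swap 0 1) 1 hv
    rw [swap_apply_of_ne_of_ne ‹_› ‹_›]
    refine tower_of_notMem _ _ ?_
    rintro j ⟨w, hw, hwv⟩
    have := h.index_eq _ _ w hw v hv hwv
    fin_cases j <;> simp_all
  · intro y hy
    exact tower_of_notMem _ _ fun i => hy _

variable [CompactSpace Y]

/-- Over a small base `f` acts on each level as one group element, so the conjugate is again a tower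
permutation of the same type. This gives normality of `alternatingFullGroup`. -/
lemma conj_tower_mem_of_local {σ : Perm ι} {K : Subgroup (topFullGroup G Y)}
    (hK : ∀ (g : ι → G) (V : Set Y) (h : IsTower g V), tower h σ ∈ K)
    (f : topFullGroup G Y) {g : ι → G} {V : Set Y} (h : IsTower g V) :
    f * tower h σ * f⁻¹ ∈ K := by
  refine tower_mem_of_local h σ (K.comap (MulAut.conj f).toMonoidHom) fun u hu => ?_
  obtain ⟨g', N, hN, huN, hf⟩ := exists_clopen_forall_apply_eq f g u
  refine ⟨N, hN, huN, fun W hW hWN _ => ?_⟩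
  have hf' : ∀ i, ∀ v ∈ W, f.1 (g i +ᵥ v) = g' i +ᵥ v := fun i v hv => hf v (hWN hv) i
  change f * tower hW σ * f⁻¹ ∈ K
  rw [conj_tower hW (isTower_of_conj hW f hf') σ f hf']
  exact hK _ _ _

instance : (alternatingFullGroup G Y).Normal := by
  constructor
  intro n hn f
  induction hn using Subgroup.closure_induction with
  | mem T hT =>
    obtain ⟨U, a, b, c, hU, h, rfl⟩ := hT
    have := threeCycle_eq_tower (isTower_of_disjointTranslates hU h) (a := 0) (b := 1) (c := 2)
      (by decide) (by decide) (by decide) hU h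
    simp only [Matrix.cons_val] at this
    rw [this]
    exact conj_tower_mem_of_local
      (fun g V h => tower_swap_mul_swap_mem h (by decide) (by decide) (by decide)) f _
  | one => simp
  | mul x y _ _ hx hy =>
    have : f * (x * y) * f⁻¹ = (f * x * f⁻¹) * (f * y * f⁻¹) := by group
    rw [this]
    exact mul_mem hx hy
  | inv x _ hx =>
    have : f * x⁻¹ * f⁻¹ = (f * x * f⁻¹)⁻¹ := by group
    rw [this]
    exact inv_mem hx

lemma alternatingFullGroup_le_commutator :
    alternatingFullGroup G Y ≤ commutator (topFullGroup G Y) := by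
  rw [alternatingFullGroup, Subgroup.closure_le]
  rintro _ ⟨U, a, b, c, hU, h, rfl⟩
  have h3 := isTower_of_disjointTranslates hU h
  have := threeCycle_eq_tower h3 (a := 0) (b := 1) (c := 2)
    (by decide) (by decide) (by decide) hU h
  simp only [Matrix.cons_val] at this
  have e : ∃ σ τ : Perm (Fin 3), swap 0 1 * swap 1 2 = ⁅σ, τ⁆ := by decide
  obtain ⟨σ, τ, he⟩ := e
  rw [this, he, map_commutatorElement]
  exact Subgroup.commutator_mem_commutator (Subgroup.mem_top _) (Subgroup.mem_top _)

variable [T2Space Y] [TotallyDisconnectedSpace Y] [AddAction.IsMinimal G Y] [Infinite Y]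

lemma infinite_of_isOpen (G : Type*) {Y : Type*} [AddCommGroup G] [AddAction G Y]
    [TopologicalSpace Y] [ContinuousConstVAdd G Y] [CompactSpace Y] [AddAction.IsMinimal G Y]
    [Infinite Y] {O : Set Y} (hO : IsOpen O) (hne : O.Nonempty) : O.Infinite := by
  intro hfin
  obtain ⟨I, hI⟩ := isCompact_univ.exists_finite_cover_vadd G hO hne
  refine Set.infinite_univ (α := Y) (Set.Finite.subset ?_ hI)
  exact I.finite_toSet.biUnion fun g _ => hfin.vadd_set

/-- By minimality finitely many translates of a non-empty open set cover the infinite space, so such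
a set stays non-empty after removal of finitely many points and every orbit meets the rest. -/
lemma exists_vadd_mem_of_finite (G : Type*) {Y : Type*} [AddCommGroup G] [AddAction G Y]
    [TopologicalSpace Y] [ContinuousConstVAdd G Y] [CompactSpace Y] [T2Space Y]
    [AddAction.IsMinimal G Y] [Infinite Y] {O F : Set Y} (hO : IsOpen O) (hne : O.Nonempty)
    (hF : F.Finite) (u : Y) : ∃ k : G, k +ᵥ u ∈ O ∧ k +ᵥ u ∉ F := by
  have h1 : IsOpen (O \ F) := hO.sdiff hF.isClosed
  have h2 : (O \ F).Nonempty := ((infinite_of_isOpen G hO hne).sdiff hF).nonempty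
  exact h1.exists_vadd_mem G u h2

/-- Modulo three-cycles, exchanging two disjoint translates of a clopen set commutes with every
element that fixes a non-empty open set pointwise. -/
lemma commute_mk_of_mem_swapFullGroup {s f : topFullGroup G Y} (hs : s ∈ swapFullGroup G Y)
    {O : Set Y} (hO : IsOpen O) (hne : O.Nonempty) (hf : ∀ y ∈ O, f.1 y = y) :
    Commute (s : topFullGroup G Y ⧸ alternatingFullGroup G Y) f := by
  set q := QuotientGroup.mk' (alternatingFullGroup G Y)
  suffices h : swapFullGroup G Y ≤ (Subgroup.centralizer {q f}).comap q by
    exact (Subgroup.mem_centralizer_singleton_iff.1 (h hs) :)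
  rw [swapFullGroup, Subgroup.closure_le]
  rintro _ ⟨g, U, h, rfl⟩
  refine tower_mem_of_local h _ _ fun u hu => ?_
  -- Two further levels are placed inside `O`, where `f` is the identity.
  obtain ⟨k, hkO, hk⟩ := exists_vadd_mem_of_finite G hO hne
    (Set.toFinite {g 0 +ᵥ u, g 1 +ᵥ u}) u
  obtain ⟨l, hlO, hl⟩ := exists_vadd_mem_of_finite G hO hne
    (Set.toFinite {g 0 +ᵥ u, g 1 +ᵥ u, k +ᵥ u}) u
  simp only [Set.mem_insert_iff, Set.mem_singleton_iff, not_or] at hk hl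
  have h01 : g 0 +ᵥ u ≠ g 1 +ᵥ u := fun he => by
    simpa using h.index_eq 0 1 u hu u hu he
  have hinj : Function.Injective fun i => (![g 0, g 1, k, l] : Fin 4 → G) i +ᵥ u := by
    intro i j hij
    fin_cases i <;> fin_cases j <;> simp_all
  obtain ⟨N, huN, hN⟩ := exists_isTower hinj
  obtain ⟨N', hN', huN', hsub⟩ := compact_exists_isClopen_in_isOpen
    ((hO.preimage (continuous_const_vadd k)).inter (hO.preimage (continuous_const_vadd l)))
    ⟨hkO, hlO⟩
  refine ⟨N ∩ N', hN.clopen.inter hN', ⟨huN, huN'⟩, fun V hV hVN hVU => ?_⟩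
  have h4 : IsTower ![g 0, g 1, k, l] V := hN.mono hV.clopen fun v hv => (hVN hv).1
  have e1 : tower hV (swap 0 1) = tower h4 (swap 0 1) := by
    symm
    rw [eq_tower_iff]
    constructor
    · intro i v hv
      fin_cases i
      · simpa using tower_vadd h4 (swap 0 1) 0 hv
      · simpa using tower_vadd h4 (swap 0 1) 1 hv
    · intro y hy
      refine tower_fixed_index h4 fun i hi => ?_
      fin_cases i
      · simpa using hy 0
      · simpa using hy 1
      · exact absurd (by decide) hi
      · exact absurd (by decide) hi
  -- The conjugator is (0 2)(1 3), written as a product of two three-cycles. It is trivial modulo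
  -- three-cycles, so there the exchange of the levels 0, 1 equals that of the levels 2, 3, which is
  -- supported in `O`.
  have e2 : (swap 0 1 : Perm (Fin 4)) = (swap 0 2 * swap 2 1 * (swap 2 1 * swap 1 3)) *
      swap 2 3 * (swap 0 2 * swap 2 1 * (swap 2 1 * swap 1 3))⁻¹ := by decide
  have hx : q (tower h4 (swap 0 2 * swap 2 1 * (swap 2 1 * swap 1 3))) = 1 := by
    rw [map_mul]
    exact (QuotientGroup.eq_one_iff _).2 (mul_mem
      (tower_swap_mul_swap_mem h4 (by decide) (by decide) (by decide))
      (tower_swap_mul_swap_mem h4 (by decide) (by decide) (by decide)))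
  have e3 : q (tower hV (swap 0 1)) = q (tower h4 (swap 2 3)) := by
    rw [e1, e2, map_mul (tower h4), map_mul (tower h4) _ (swap 2 3), map_inv, map_mul q, map_mul q,
      map_inv, hx, one_mul, inv_one, mul_one]
  have e4 : tower h4 (swap 2 3) * f = f * tower h4 (swap 2 3) := by
    refine topFullGroup_ext fun y => ?_
    change (tower h4 (swap 2 3)).1 (f.1 y) = f.1 ((tower h4 (swap 2 3)).1 y)
    have hO' : ∀ i v, v ∈ V → (i = 2 ∨ i = 3) → (![g 0, g 1, k, l] : Fin 4 → G) i +ᵥ v ∈ O := by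
      rintro i v hv (rfl | rfl)
      · exact (hsub (hVN hv).2).1
      · exact (hsub (hVN hv).2).2
    have hfix : ∀ z, z ∉ O → (tower h4 (swap 2 3)).1 z = z := by
      intro z hz
      refine tower_fixed_index h4 ?_
      rintro i hi ⟨v, hv, rfl⟩
      refine hz (hO' i v hv ?_)
      clear hz
      revert hi
      revert i
      decide
    by_cases hy : y ∈ O
    · rw [hf y hy]
      symm
      apply hf
      by_contra hcon
      have := hfix _ hcon
      have h2 := (tower h4 (swap 2 3)).1.injective this
      exact hcon (by rw [h2]; exact hy)
    · rw [hfix y hy, hfix]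
      intro hcon
      have := f.1.injective (hf _ hcon)
      rw [this] at hcon
      exact hy hcon
  rw [Subgroup.mem_comap, Subgroup.mem_centralizer_singleton_iff, e3, ← map_mul, ← map_mul, e4]

/-- The elements of the group generated by exchanges commute modulo three-cycles. -/
lemma commute_mk_of_mem_swapFullGroup_of_mem {s t : topFullGroup G Y}
    (hs : s ∈ swapFullGroup G Y) (ht : t ∈ swapFullGroup G Y) :
    Commute (s : topFullGroup G Y ⧸ alternatingFullGroup G Y) t := by
  set q := QuotientGroup.mk' (alternatingFullGroup G Y)
  suffices h : swapFullGroup G Y ≤ (Subgroup.centralizer {q t}).comap q by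
    exact (Subgroup.mem_centralizer_singleton_iff.1 (h hs) :)
  rw [swapFullGroup, Subgroup.closure_le]
  rintro _ ⟨g, U, h, rfl⟩
  refine tower_mem_of_local h _ _ fun u hu => ?_
  -- A third level, disjoint from the two exchanged ones, is an open set fixed by the small
  -- exchange. So the previous lemma applies with the exchange in the role of `f`.
  obtain ⟨k, -, hk⟩ := exists_vadd_mem_of_finite G isOpen_univ ⟨u, Set.mem_univ u⟩
    (Set.toFinite {g 0 +ᵥ u, g 1 +ᵥ u}) u
  simp only [Set.mem_insert_iff, Set.mem_singleton_iff, not_or] at hk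
  have h01 : g 0 +ᵥ u ≠ g 1 +ᵥ u := fun he => by
    simpa using h.index_eq 0 1 u hu u hu he
  have hinj : Function.Injective fun i => (![g 0, g 1, k] : Fin 3 → G) i +ᵥ u := by
    intro i j hij
    fin_cases i <;> fin_cases j <;> simp_all
  obtain ⟨N, huN, hN⟩ := exists_isTower hinj
  refine ⟨N, hN.clopen, huN, fun V hV hVN hVU => ?_⟩
  refine Subgroup.mem_centralizer_singleton_iff.2 ?_
  refine (commute_mk_of_mem_swapFullGroup ht (isClopen_translate hN.clopen k).2
    ⟨_, Set.vadd_mem_vadd_set huN⟩ (f := tower hV (swap 0 1)) ?_).symm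
  rintro _ ⟨v, hv, rfl⟩
  refine tower_of_notMem hV _ ?_
  rintro i ⟨w, hw, hwv⟩
  have := hN.index_eq ((![0, 1] : Fin 2 → Fin 3) i) 2 w (hVN hw) v hv
    (by fin_cases i <;> simpa using hwv)
  clear hwv
  revert this
  revert i
  decide

end Compact

/-! ### Exchanges that shrink the support, and greedy matchings. -/

section Support

variable {G Y : Type*} [AddCommGroup G] [AddAction G Y] [TopologicalSpace Y]

/-- The set of points moved by an element of the topological full group. -/
def moved (f : topFullGroup G Y) : Set Y := {y | f.1 y ≠ y}

lemma isClopen_moved (hfree : ∀ (g : G) (y : Y), g +ᵥ y = y → g = 0) (f : topFullGroup G Y) :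
    IsClopen (moved f) := by
  obtain ⟨c, hc, hf⟩ := f.2
  have : moved f = (c ⁻¹' {0})ᶜ := by
    ext y
    simp only [moved, Set.mem_ofPred_eq, Set.mem_compl_iff, Set.mem_preimage,
      Set.mem_singleton_iff, hf]
    refine not_congr ⟨hfree _ _, fun h => by rw [h, zero_vadd]⟩
  rw [this]
  exact (hc.isClopen_fiber 0).compl

variable [ContinuousConstVAdd G Y] [CompactSpace Y]

/-- If `f` moves a clopen set `U` off itself, then the exchange of `U` and `f U` belongs to the
group generated by exchanges. -/
lemma exists_exchange (f : topFullGroup G Y) {U : Set Y} (hU : IsClopen U)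
    (hfU : ∀ u ∈ U, f.1 u ∉ U) :
    ∃ s ∈ swapFullGroup G Y, (∀ u ∈ U, s.1 u = f.1 u ∧ s.1 (f.1 u) = u) ∧
      ∀ y, y ∉ U → (∀ u ∈ U, f.1 u ≠ y) → s.1 y = y := by
  refine clopen_induction hU (fun U => ∃ s ∈ swapFullGroup G Y,
    (∀ u ∈ U, s.1 u = f.1 u ∧ s.1 (f.1 u) = u) ∧
      ∀ y, y ∉ U → (∀ u ∈ U, f.1 u ≠ y) → s.1 y = y) ?_ ?_ ?_
  · exact ⟨1, one_mem _, by simp, fun y _ _ => rfl⟩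
  · rintro V W hV hW hVU hWU hd ⟨s, hs, hs1, hs2⟩ ⟨t, ht, ht1, ht2⟩
    have hd' := Set.disjoint_left.1 hd
    refine ⟨s * t, mul_mem hs ht, ?_, ?_⟩
    · rintro u (hu | hu)
      · have h1 : t.1 u = u := ht2 u (hd' hu) fun w hw hwu => hfU w (hWU hw) (hwu ▸ hVU hu)
        have h2 : t.1 (f.1 u) = f.1 u := ht2 _ (fun h => hfU u (hVU hu) (hWU h))
          fun w hw hwu => hd' hu (f.1.injective hwu ▸ hw)
        change s.1 (t.1 u) = _ ∧ s.1 (t.1 (f.1 u)) = u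
        rw [h1, h2]
        exact hs1 u hu
      · have h1 : s.1 u = u := hs2 u (fun h => hd' h hu)
          fun w hw hwu => hfU w (hVU hw) (hwu ▸ hWU hu)
        have h2 : s.1 (f.1 u) = f.1 u := hs2 _ (fun h => hfU u (hWU hu) (hVU h))
          fun w hw hwu => hd' hw (f.1.injective hwu ▸ hu)
        change s.1 (t.1 u) = _ ∧ s.1 (t.1 (f.1 u)) = u
        rw [(ht1 u hu).1, (ht1 u hu).2, h1, h2]
        exact ⟨rfl, rfl⟩
    · intro y hy hy'
      change s.1 (t.1 y) = y
      rw [ht2 y (fun h => hy (Or.inr h)) (fun u hu => hy' u (Or.inr hu)),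
        hs2 y (fun h => hy (Or.inl h)) (fun u hu => hy' u (Or.inl hu))]
  · intro u hu
    obtain ⟨g', N, hN, huN, hN'⟩ := exists_clopen_forall_apply_eq f (fun _ : Unit => (0 : G)) u
    refine ⟨N, hN, huN, fun V hV hVN hVU => ?_⟩
    have hf : ∀ v ∈ V, f.1 v = g' () +ᵥ v := fun v hv => by simpa using hN' v (hVN hv) ()
    have hT : IsTower ![0, g' ()] V := by
      refine ⟨hV, fun i j x hx y hy hxy => ?_⟩
      have aux : ∀ x ∈ V, ∀ y ∈ V, x ≠ g' () +ᵥ y := fun x hx y hy h =>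
        hfU y (hVU hy) (by rw [hf y hy, ← h]; exact hVU hx)
      fin_cases i <;> fin_cases j <;> simp at hxy ⊢
      · exact aux x hx y hy hxy
      · exact aux y hy x hx hxy.symm
    refine ⟨tower hT (swap 0 1), tower_swap_mem hT (by decide), fun v hv => ?_, fun y hy hy' => ?_⟩
    · have h0 := tower_vadd hT (swap 0 1) 0 hv
      have h1 := tower_vadd hT (swap 0 1) 1 hv
      rw [hf v hv]
      simpa using And.intro h0 h1
    · refine tower_of_notMem hT _ ?_
      rintro i ⟨v, hv, hvy⟩
      fin_cases i
      · have : v = y := by simpa using hvy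
        exact hy (this ▸ hv)
      · exact hy' v hv ((hf v hv).trans (by simpa using hvy))

variable [T2Space Y] [TotallyDisconnectedSpace Y]

/-- Every element of the topological full group has a maximal clopen independent set for the
relation `y ∼ f y` on its support. -/
lemma exists_maximal_independent (hfree : ∀ (g : G) (y : Y), g +ᵥ y = y → g = 0)
    (f : topFullGroup G Y) :
    ∃ U, IsClopen U ∧ (∀ u ∈ U, f.1 u ∉ U) ∧
      ∀ y ∈ moved f, y ∈ U ∨ f.1 y ∈ U ∨ (f⁻¹).1 y ∈ U := by
  -- The induction extends an arbitrary independent set, so that the pieces of the support can be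
  -- treated one after another.
  have key := clopen_induction (isClopen_moved hfree f)
    (fun E => ∀ U, IsClopen U → (∀ u ∈ U, f.1 u ∉ U) → ∃ U', IsClopen U' ∧ (∀ u ∈ U', f.1 u ∉ U') ∧
      U ⊆ U' ∧ ∀ y ∈ E, y ∈ U' ∨ f.1 y ∈ U' ∨ (f⁻¹).1 y ∈ U') ?_ ?_ ?_
  · obtain ⟨U, h1, h2, -, h3⟩ := key ∅ isClopen_empty (by simp)
    exact ⟨U, h1, h2, h3⟩
  · exact fun U h1 h2 => ⟨U, h1, h2, subset_rfl, by simp⟩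
  · intro V W _ _ _ _ _ hPV hPW U hU hfU
    obtain ⟨U1, a1, a2, a3, a4⟩ := hPV U hU hfU
    obtain ⟨U2, b1, b2, b3, b4⟩ := hPW U1 a1 a2
    refine ⟨U2, b1, b2, a3.trans b3, ?_⟩
    rintro y (hy | hy)
    · exact (a4 y hy).imp (@b3 _) (Or.imp (@b3 _) (@b3 _))
    · exact b4 y hy
  · intro u hu
    have hcont : Continuous f.1 := f.1.continuous
    obtain ⟨A, B, hA, hB, hfuA, huB, hd⟩ := t2_separation hu
    obtain ⟨N, hN, huN, hNAB⟩ := compact_exists_isClopen_in_isOpen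
      ((hA.preimage hcont).inter hB) ⟨hfuA, huB⟩
    refine ⟨N, hN, huN, fun E hE hEN hEm U hU hfU => ?_⟩
    have hEE : ∀ x ∈ E, f.1 x ∉ E := fun x hx hx' =>
      Set.disjoint_left.1 hd (hNAB (hEN hx)).1 (hNAB (hEN hx')).2
    -- All points of `E` not adjacent to `U` are added. They are mutually independent because `N`,
    -- and hence `E`, is disjoint from its image under `f`.
    refine ⟨U ∪ (E \ (f.1 ⁻¹' U ∪ (f⁻¹).1 ⁻¹' U)), hU.union (hE.diff ((hU.preimage hcont).union
      (hU.preimage (f⁻¹).1.continuous))), ?_, Set.subset_union_left, ?_⟩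
    · have hinv : ∀ x, (f⁻¹).1 (f.1 x) = x := fun x => f.1.symm_apply_apply x
      rintro x (hx | ⟨hxE, hx⟩) (hx' | ⟨hxE', hx'⟩)
      · exact hfU x hx hx'
      · exact hx' (Or.inr (by rw [Set.mem_preimage, hinv]; exact hx))
      · exact hx (Or.inl hx')
      · exact hEE x hxE hxE'
    · intro y hy
      by_cases h : y ∈ f.1 ⁻¹' U ∪ (f⁻¹).1 ⁻¹' U
      · exact Or.inr (h.imp Or.inl Or.inl)
      · exact Or.inl (Or.inr ⟨hy, h⟩)

/-- Composing with a product of exchanges, one can remove a maximal independent set from the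
support of an element of the topological full group. -/
lemma exists_remove (hfree : ∀ (g : G) (y : Y), g +ᵥ y = y → g = 0) (f : topFullGroup G Y) :
    ∃ s ∈ swapFullGroup G Y, ∃ U ⊆ moved f, moved (s * f) ⊆ moved f \ U ∧
      ∀ y ∈ moved f, y ∈ U ∨ f.1 y ∈ U ∨ (f⁻¹).1 y ∈ U := by
  obtain ⟨U, hU, hfU, hmax⟩ := exists_maximal_independent hfree f
  obtain ⟨s, hs, hs1, hs2⟩ := exists_exchange f hU hfU
  have hUm : U ⊆ moved f := fun u hu h => hfU u hu (by rw [h]; exact hu)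
  refine ⟨s, hs, U, hUm, fun y hy => ⟨fun hfy => hy ?_, fun hyU => hy (hs1 y hyU).2⟩, hmax⟩
  change s.1 (f.1 y) = y
  rw [hfy]
  refine hs2 y (fun h => hUm h hfy) fun u hu huy => hUm hu ?_
  have : u = y := f.1.injective (huy.trans hfy.symm)
  rw [this]
  exact hfy

/-- The translations in `l` are used one at a time: each exchanges all still unmatched points `x` of
`U` with `a +ᵥ x` whenever that is an unmatched point of `V`. At the end no translation in `l` joins
two unmatched points. -/
lemma exists_greedy_matching (l : List G) {U V : Set Y} (hU : IsClopen U)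
    (hV : IsClopen V) (hd : Disjoint U V) :
    ∃ s ∈ swapFullGroup G Y, ∃ U₁ V₁, IsClopen U₁ ∧ IsClopen V₁ ∧ U₁ ⊆ U ∧ V₁ ⊆ V ∧
      (∀ u ∈ U₁, s.1 u ∈ V₁) ∧ (∀ v ∈ V₁, s.1 v ∈ U₁ ∧ ∃ a ∈ l, a +ᵥ s.1 v = v) ∧
      (∀ y, y ∉ U₁ → y ∉ V₁ → s.1 y = y) ∧ ∀ a ∈ l, ∀ x ∈ U \ U₁, a +ᵥ x ∉ V \ V₁ := by
  induction l with
  | nil => exact ⟨1, one_mem _, ∅, ∅, isClopen_empty, isClopen_empty, by simp, by simp, by simp,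
      by simp, fun y _ _ => rfl, by simp⟩
  | cons a l ih =>
    obtain ⟨s, hs, U₁, V₁, hU₁, hV₁, hUU, hVV, h1, h2, h3, h4⟩ := ih
    have hdisj : ∀ {x}, x ∈ U → x ∉ V := fun hx => Set.disjoint_left.1 hd hx
    set W := (U \ U₁) ∩ (a +ᵥ ·) ⁻¹' (V \ V₁) with hW
    have hWc : IsClopen W :=
      (hU.diff hU₁).inter ((hV.diff hV₁).preimage (continuous_const_vadd a))
    have hT : IsTower ![0, a] W := by
      refine ⟨hWc, fun i j x hx y hy hxy => ?_⟩
      have aux : ∀ x ∈ W, ∀ y ∈ W, x ≠ a +ᵥ y := fun x hx y hy h =>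
        hdisj hx.1.1 (h ▸ hy.2.1)
      fin_cases i <;> fin_cases j <;> simp at hxy ⊢
      · exact aux x hx y hy hxy
      · exact aux y hy x hx hxy.symm
    set t := tower hT (swap 0 1) with ht
    have ht0 : ∀ v ∈ W, t.1 v = a +ᵥ v := fun v hv => by
      simpa using tower_vadd hT (swap 0 1) 0 hv
    have ht1 : ∀ v ∈ W, t.1 (a +ᵥ v) = v := fun v hv => by
      simpa using tower_vadd hT (swap 0 1) 1 hv
    have ht2 : ∀ y, y ∉ W → y ∉ a +ᵥ W → t.1 y = y := by
      intro y hy hy'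
      refine tower_of_notMem hT _ fun i => ?_
      fin_cases i
      · simpa using hy
      · simpa using hy'
    have hWV : ∀ y ∈ a +ᵥ W, y ∈ V \ V₁ := by
      rintro _ ⟨w, hw, rfl⟩
      exact hw.2
    have htU : ∀ y ∈ U₁, t.1 y = y := fun y hy =>
      ht2 y (fun h => h.1.2 hy) fun h => hdisj (hUU hy) (hWV y h).1
    have htV : ∀ y ∈ V₁, t.1 y = y := fun y hy =>
      ht2 y (fun h => hdisj h.1.1 (hVV hy)) fun h => (hWV y h).2 hy
    refine ⟨s * t, mul_mem hs (tower_swap_mem hT (by decide)), U₁ ∪ W, V₁ ∪ (a +ᵥ W),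
      hU₁.union hWc, hV₁.union (isClopen_translate hWc a),
      Set.union_subset hUU fun x hx => hx.1.1, Set.union_subset hVV fun x hx => (hWV x hx).1,
      ?_, ?_, ?_, ?_⟩
    · rintro u (hu | hu)
      · change s.1 (t.1 u) ∈ _
        rw [htU u hu]
        exact Or.inl (h1 u hu)
      · change s.1 (t.1 u) ∈ _
        have : a +ᵥ u ∈ a +ᵥ W := Set.vadd_mem_vadd_set hu
        rw [ht0 u hu, h3 _ (fun h => hdisj (hUU h) hu.2.1) hu.2.2]
        exact Or.inr this
    · rintro v (hv | ⟨u, hu, rfl⟩)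
      · change s.1 (t.1 v) ∈ _ ∧ ∃ b ∈ a :: l, b +ᵥ s.1 (t.1 v) = v
        rw [htV v hv]
        obtain ⟨h5, b, hb, h6⟩ := h2 v hv
        exact ⟨Or.inl h5, b, List.mem_cons_of_mem _ hb, h6⟩
      · change s.1 (t.1 (a +ᵥ u)) ∈ _ ∧ ∃ b ∈ a :: l, b +ᵥ s.1 (t.1 (a +ᵥ u)) = a +ᵥ u
        rw [ht1 u hu, h3 u hu.1.2 fun h => hdisj hu.1.1 (hVV h)]
        exact ⟨Or.inr hu, a, List.mem_cons_self, rfl⟩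
    · intro y hyU hyV
      change s.1 (t.1 y) = y
      rw [ht2 y (fun h => hyU (Or.inr h)) fun h => hyV (Or.inr h),
        h3 y (fun h => hyU (Or.inl h)) fun h => hyV (Or.inl h)]
    · intro b hb x hx hbx
      have hx1 : x ∈ U \ U₁ := ⟨hx.1, fun h => hx.2 (Or.inl h)⟩
      have hx2 : b +ᵥ x ∈ V \ V₁ := ⟨hbx.1, fun h => hbx.2 (Or.inl h)⟩
      rcases List.mem_cons.1 hb with rfl | hb
      · exact hx.2 (Or.inr ⟨hx1, hx2⟩)
      · exact h4 b hb x hx1 hx2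

end Support

/-! ### Counting visits in cubes, and the commutator subgroup modulo three-cycles. -/

section Density

variable {d : ℕ}

variable (d) in
/-- The cube of radius `D` around `0` in `ℤ^d`. -/
noncomputable def cube (D : ℕ) : Finset (Fin d → ℤ) := Fintype.piFinset fun _ => Finset.Icc (-(D : ℤ)) D

lemma mem_cube {D : ℕ} {a : Fin d → ℤ} : a ∈ cube d D ↔ ∀ i, -(D : ℤ) ≤ a i ∧ a i ≤ D := by
  simp [cube]

lemma card_cube (D : ℕ) : (cube d D).card = (2 * D + 1) ^ d := by
  simp only [cube, Fintype.card_piFinset, Int.card_Icc, Finset.prod_const, Finset.card_univ,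
    Fintype.card_fin]
  congr 1
  omega

lemma add_mem_cube {D E : ℕ} {a b : Fin d → ℤ} (ha : a ∈ cube d D) (hb : b ∈ cube d E) :
    a + b ∈ cube d (D + E) := by
  rw [mem_cube] at *
  intro i
  have := ha i
  have := hb i
  simp only [Pi.add_apply]
  omega

lemma neg_mem_cube {D : ℕ} {a : Fin d → ℤ} (ha : a ∈ cube d D) : -a ∈ cube d D := by
  rw [mem_cube] at *
  intro i
  have := ha i
  simp only [Pi.neg_apply]
  omega

lemma cube_mono {D E : ℕ} (h : D ≤ E) : cube d D ⊆ cube d E := by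
  intro a ha
  rw [mem_cube] at *
  intro i
  have := ha i
  omega

lemma exists_subset_cube (s : Finset (Fin d → ℤ)) : ∃ L, s ⊆ cube d L := by
  refine ⟨s.sup fun a => Finset.univ.sup fun i => (a i).natAbs, fun a ha => ?_⟩
  rw [mem_cube]
  intro i
  have h1 : (a i).natAbs ≤ Finset.univ.sup fun i => (a i).natAbs :=
    Finset.le_sup (f := fun i => (a i).natAbs) (Finset.mem_univ i)
  have h2 := Finset.le_sup (f := fun a : Fin d → ℤ => Finset.univ.sup fun i => (a i).natAbs) ha
  have h3 := h1.trans h2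
  omega

variable {Y : Type*} [AddAction (Fin d → ℤ) Y]

open Classical in
/-- The elements of a cube that move `x` into `E`. -/
noncomputable def visits (E : Set Y) (x : Y) (D : ℕ) : Finset (Fin d → ℤ) :=
  (cube d D).filter fun a => a +ᵥ x ∈ E

lemma mem_visits {E : Set Y} {x : Y} {D : ℕ} {a : Fin d → ℤ} :
    a ∈ visits E x D ↔ a ∈ cube d D ∧ a +ᵥ x ∈ E := by
  classical
  simp [visits]

lemma visits_mono {E F : Set Y} (h : E ⊆ F) (x : Y) {D D' : ℕ} (hD : D ≤ D') :
    (visits E x D : Finset (Fin d → ℤ)) ⊆ visits F x D' := by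
  intro a ha
  rw [mem_visits] at *
  exact ⟨cube_mono hD ha.1, h ha.2⟩

/-- By freeness the points of an orbit correspond to the vectors of ℤ^d, so an injective map with
displacements in `cube d L` injects the visits, enlarging the radius by at most `L`. -/
lemma card_visits_le_of_map (hfree : ∀ (g : Fin d → ℤ) (y : Y), g +ᵥ y = y → g = 0)
    {E F : Set Y} {θ : Y → Y} (hθ : Set.InjOn θ E) (hEF : Set.MapsTo θ E F) {L : ℕ}
    (hL : ∀ y ∈ E, ∃ a ∈ cube d L, θ y = a +ᵥ y) (x : Y) (D : ℕ) :
    (visits E x D : Finset (Fin d → ℤ)).card ≤ (visits F x (D + L) : Finset (Fin d → ℤ)).card := by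
  choose! e he1 he2 using hL
  refine Finset.card_le_card_of_injOn (fun a => a + e (a +ᵥ x)) ?_ ?_
  · intro a ha
    rw [Finset.mem_coe, mem_visits] at *
    refine ⟨add_mem_cube ha.1 (he1 _ ha.2), ?_⟩
    change (a + e (a +ᵥ x)) +ᵥ x ∈ F
    rw [add_comm, add_vadd, ← he2 _ ha.2]
    exact hEF ha.2
  · intro a ha b hb hab
    rw [Finset.mem_coe, mem_visits] at *
    have h1 : θ (a +ᵥ x) = θ (b +ᵥ x) := by
      rw [he2 _ ha.2, he2 _ hb.2, ← add_vadd, ← add_vadd, add_comm, add_comm _ b]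
      exact congrArg (· +ᵥ x) hab
    have h2 := hθ ha.2 hb.2 h1
    have h3 : (-b + a) +ᵥ x = x := by rw [add_vadd, h2, neg_vadd_vadd]
    have h4 := hfree _ _ h3
    rw [neg_add_eq_zero] at h4
    exact h4.symm

/-- The set `E` has upper density at most `(2/3)^k`, up to a bounded error in the radius. -/
def HasSmallDensity (d : ℕ) {Y : Type*} [AddAction (Fin d → ℤ) Y] (k : ℕ) (E : Set Y) : Prop :=
  ∃ L, ∀ x D, 3 ^ k * (visits E x D : Finset (Fin d → ℤ)).card ≤ 2 ^ k * (cube d (D + L)).card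

variable [TopologicalSpace Y] [ContinuousConstVAdd (Fin d → ℤ) Y] [CompactSpace Y]

lemma exists_cube_cocycle (f : topFullGroup (Fin d → ℤ) Y) :
    ∃ L, ∀ y, ∃ a ∈ cube d L, f.1 y = a +ᵥ y := by
  obtain ⟨c, hc, hf⟩ := f.2
  obtain ⟨L, hL⟩ := exists_subset_cube hc.range_finite.toFinset
  exact ⟨L, fun y => ⟨c y, hL (by simp), hf y⟩⟩

variable [T2Space Y] [TotallyDisconnectedSpace Y]

/-- Removing a maximal independent set `U` from the support leaves points that lie in f⁻¹(U) or
f(U). So the rest has at most twice the density of `U`, that is, at most 2/3 of the density of the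
old support. -/
lemma exists_smallDensity (hfree : ∀ (g : Fin d → ℤ) (y : Y), g +ᵥ y = y → g = 0)
    (f : topFullGroup (Fin d → ℤ) Y) (k : ℕ) :
    ∃ s ∈ swapFullGroup (Fin d → ℤ) Y, HasSmallDensity d k (moved (s * f)) := by
  induction k with
  | zero =>
    refine ⟨1, one_mem _, 0, fun x D => ?_⟩
    simp only [pow_zero, one_mul]
    exact Finset.card_le_card fun a ha => (mem_visits.1 ha).1
  | succ k ih =>
    obtain ⟨s, hs, L, hL⟩ := ih
    obtain ⟨t, ht, U, hU, hm, hmax⟩ := exists_remove hfree (s * f)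
    refine ⟨t * s, mul_mem ht hs, ?_⟩
    rw [mul_assoc]
    generalize s * f = f' at *
    obtain ⟨L₀, hL₀⟩ := exists_cube_cocycle f'
    obtain ⟨L₁, hL₁⟩ := exists_cube_cocycle f'⁻¹
    refine ⟨L₀ + L₁ + L, fun x D => ?_⟩
    have h1 := card_visits_le_of_map hfree (E := {y | f'.1 y ∈ U}) (F := U) f'.1.injective.injOn
      (fun y hy => hy) (fun y _ => hL₀ y) x D
    have h2 := card_visits_le_of_map hfree (E := {y | (f'⁻¹).1 y ∈ U}) (F := U)
      (f'⁻¹).1.injective.injOn (fun y hy => hy) (fun y _ => hL₁ y) x D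
    have h1' : (visits U x (D + L₀) : Finset (Fin d → ℤ)).card ≤
        (visits U x (D + (L₀ + L₁)) : Finset (Fin d → ℤ)).card :=
      Finset.card_le_card (visits_mono subset_rfl x (by omega))
    have h2' : (visits U x (D + L₁) : Finset (Fin d → ℤ)).card ≤
        (visits U x (D + (L₀ + L₁)) : Finset (Fin d → ℤ)).card :=
      Finset.card_le_card (visits_mono subset_rfl x (by omega))
    have h3 : (visits (moved (t * f')) x D : Finset (Fin d → ℤ)).card ≤
        (visits {y | f'.1 y ∈ U} x D : Finset (Fin d → ℤ)).card +
        (visits {y | (f'⁻¹).1 y ∈ U} x D : Finset (Fin d → ℤ)).card := by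
      classical
      refine le_trans (Finset.card_le_card ?_) (Finset.card_union_le _ _)
      intro a ha
      rw [Finset.mem_union, mem_visits, mem_visits]
      rw [mem_visits] at ha
      obtain ⟨h4, h5⟩ := hm ha.2
      exact ((hmax _ h4).resolve_left h5).imp (⟨ha.1, ·⟩) (⟨ha.1, ·⟩)
    have h4 : (visits (moved (t * f')) x D : Finset (Fin d → ℤ)).card +
        (visits U x (D + (L₀ + L₁)) : Finset (Fin d → ℤ)).card ≤
        (visits (moved f') x (D + (L₀ + L₁)) : Finset (Fin d → ℤ)).card := by
      classical
      rw [← Finset.card_union_of_disjoint]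
      · exact Finset.card_le_card (Finset.union_subset
          (visits_mono (hm.trans Set.sdiff_subset) x (by omega)) (visits_mono hU x le_rfl))
      · rw [Finset.disjoint_left]
        intro a ha ha'
        rw [mem_visits] at ha ha'
        exact (hm ha.2).2 ha'.2
    have h5 := hL x (D + (L₀ + L₁))
    have h6 : 3 * (visits (moved (t * f')) x D : Finset (Fin d → ℤ)).card ≤
        2 * (visits (moved f') x (D + (L₀ + L₁)) : Finset (Fin d → ℤ)).card := by omega
    calc 3 ^ (k + 1) * (visits (moved (t * f')) x D : Finset (Fin d → ℤ)).card
        = 3 ^ k * (3 * (visits (moved (t * f')) x D : Finset (Fin d → ℤ)).card) := by ring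
      _ ≤ 3 ^ k * (2 * (visits (moved f') x (D + (L₀ + L₁)) : Finset (Fin d → ℤ)).card) := by gcongr
      _ = 2 * (3 ^ k * (visits (moved f') x (D + (L₀ + L₁)) : Finset (Fin d → ℤ)).card) := by ring
      _ ≤ 2 * (2 ^ k * (cube d (D + (L₀ + L₁) + L)).card) := by gcongr
      _ = 2 ^ (k + 1) * (cube d (D + (L₀ + L₁ + L))).card := by
        rw [add_assoc D]
        ring

/-- The inequality is 24 < 27 raised to the power d + 1. It chooses the exponent 3(d + 1): the
density (2/3)^(3(d+1)) beats a factor 3^d from enlarging cubes and a factor 3 from adding three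
counts. -/
lemma two_pow_mul_lt (d : ℕ) : 3 ^ (d + 1) * 2 ^ (3 * (d + 1)) < 3 ^ (3 * (d + 1)) := by
  rw [pow_mul, pow_mul, ← mul_pow]
  exact Nat.pow_lt_pow_left (by norm_num) (by omega)

lemma HasSmallDensity.exists_bound {E : Set Y} {k : ℕ} (h : HasSmallDensity d k E) :
    ∃ L, ∀ x, ∀ D ≥ L, ∀ D' ≤ 2 * D,
      3 ^ k * (visits E x D' : Finset (Fin d → ℤ)).card ≤ 2 ^ k * (3 ^ d * (2 * D + 1) ^ d) := by
  obtain ⟨L, hL⟩ := h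
  refine ⟨L, fun x D hD D' hD' => (hL x D').trans ?_⟩
  rw [card_cube, ← mul_pow]
  gcongr
  omega

lemma HasSmallDensity.exists_notMem [Nonempty Y] {E : Set Y}
    (h : HasSmallDensity d (3 * (d + 1)) E) : ∃ y, y ∉ E := by
  by_contra! hE
  obtain ⟨L, hL⟩ := h.exists_bound
  have h1 := hL (Classical.arbitrary Y) L le_rfl L (by omega)
  have h2 : (visits E (Classical.arbitrary Y) L : Finset (Fin d → ℤ)) = cube d L := by
    ext a
    simp [mem_visits, hE]
  rw [h2, card_cube, ← mul_assoc] at h1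
  have h3 := Nat.le_of_mul_le_mul_right h1 (by positivity)
  have h4 := two_pow_mul_lt d
  have h5 : 3 ^ (d + 1) * 2 ^ (3 * (d + 1)) = 3 * (2 ^ (3 * (d + 1)) * 3 ^ d) := by ring
  omega

/-- Two clopen sets of small density can be made disjoint by a product of exchanges. -/
lemma exists_swapFullGroup_disjoint (hfree : ∀ (g : Fin d → ℤ) (y : Y), g +ᵥ y = y → g = 0)
    {M M' : Set Y} (hM : IsClopen M) (hM' : IsClopen M')
    (hdM : HasSmallDensity d (3 * (d + 1)) M) (hdM' : HasSmallDensity d (3 * (d + 1)) M') :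
    ∃ s ∈ swapFullGroup (Fin d → ℤ) Y, ∀ y ∈ M, s.1 y ∉ M' := by
  obtain ⟨L, hL⟩ := hdM.exists_bound
  obtain ⟨L', hL'⟩ := hdM'.exists_bound
  set D := L + L'
  -- The overlap of `M` and `M'` is matched with points outside both sets.
  obtain ⟨s, hs, U, V, hU, hV, hUM, hVM, h1, h2, h3, h4⟩ :=
    exists_greedy_matching (cube d D).toList (hM.inter hM') (hM.union hM').compl
      (Set.disjoint_left.2 fun x hx hx' => hx' (Or.inl hx.1))
  have hall : ∀ x ∈ M ∩ M', x ∈ U := by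
    intro x hx
    by_contra hxU
    have hVcard : (visits V x D : Finset (Fin d → ℤ)).card ≤
        (visits M x (D + D) : Finset (Fin d → ℤ)).card := by
      refine card_visits_le_of_map hfree s.1.injective.injOn
        (fun v hv => (hUM (h2 v hv).1).1) (fun v hv => ?_) x D
      obtain ⟨-, a, ha, hav⟩ := h2 v hv
      exact ⟨-a, neg_mem_cube (by simpa using ha), by rw [eq_neg_vadd_iff, hav]⟩
    -- Around an unmatched point `x` every point of the cube lies in `M`, in `M'`, or is already
    -- matched. The matched ones inject into visits of `M` in the cube of radius 2D, so the three
    -- counts are too small to cover the cube.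
    have hcov : cube d D ⊆ visits M x D ∪ visits M' x D ∪ visits V x D := by
      classical
      intro a ha
      have := h4 a (by simpa using ha) x ⟨hx, hxU⟩
      simp only [Finset.mem_union, mem_visits, ha, true_and]
      by_contra hcon
      push Not at hcon
      exact this ⟨fun h => h.elim hcon.1.1 hcon.1.2, hcon.2⟩
    have hcard := (Finset.card_le_card hcov).trans ((Finset.card_union_le _ _).trans
      (Nat.add_le_add_right (Finset.card_union_le _ _) _))
    rw [card_cube] at hcard
    have b1 := hL x D (by omega) D (by omega)
    have b2 := hL' x D (by omega) D (by omega)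
    have b3 := hL x D (by omega) (D + D) (by omega)
    have h5 : 3 ^ (3 * (d + 1)) * (2 * D + 1) ^ d ≤
        3 ^ (d + 1) * 2 ^ (3 * (d + 1)) * (2 * D + 1) ^ d := by
      calc 3 ^ (3 * (d + 1)) * (2 * D + 1) ^ d
          ≤ 3 ^ (3 * (d + 1)) * ((visits M x D : Finset (Fin d → ℤ)).card +
            (visits M' x D : Finset (Fin d → ℤ)).card +
            (visits M x (D + D) : Finset (Fin d → ℤ)).card) := by
            gcongr
            omega
        _ = 3 ^ (3 * (d + 1)) * (visits M x D : Finset (Fin d → ℤ)).card +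
            3 ^ (3 * (d + 1)) * (visits M' x D : Finset (Fin d → ℤ)).card +
            3 ^ (3 * (d + 1)) * (visits M x (D + D) : Finset (Fin d → ℤ)).card := by ring
        _ ≤ _ := by
          have : 3 ^ (d + 1) * 2 ^ (3 * (d + 1)) * (2 * D + 1) ^ d =
            3 * (2 ^ (3 * (d + 1)) * (3 ^ d * (2 * D + 1) ^ d)) := by ring
          omega
    exact absurd (Nat.le_of_mul_le_mul_right h5 (by positivity)) (not_le.2 (two_pow_mul_lt d))
  refine ⟨s, hs, fun y hy hsy => ?_⟩
  by_cases hyU : y ∈ U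
  · exact hVM (h1 y hyU) (Or.inr hsy)
  · have : s.1 y = y := h3 y hyU fun h => hVM h (Or.inl hy)
    rw [this] at hsy
    exact hyU (hall y ⟨hy, hsy⟩)

variable [AddAction.IsMinimal (Fin d → ℤ) Y] [Infinite Y]

/-- The commutator subgroup of the topological full group is generated by three-cycles. -/
lemma commutator_le_alternatingFullGroup
    (hfree : ∀ (g : Fin d → ℤ) (y : Y), g +ᵥ y = y → g = 0) :
    commutator (topFullGroup (Fin d → ℤ) Y) ≤ alternatingFullGroup (Fin d → ℤ) Y := by
  rw [commutator_def, Subgroup.commutator_le]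
  intro f _ g _
  set q := QuotientGroup.mk' (alternatingFullGroup (Fin d → ℤ) Y)
  obtain ⟨s, hs, hf⟩ := exists_smallDensity hfree f (3 * (d + 1))
  obtain ⟨t, ht, hg⟩ := exists_smallDensity hfree g (3 * (d + 1))
  have hcf := isClopen_moved hfree (s * f)
  have hcg := isClopen_moved hfree (t * g)
  obtain ⟨h, hh, hd⟩ := exists_swapFullGroup_disjoint hfree hcf hcg hf hg
  have hef : f = s⁻¹ * (s * f) := by group
  have heg : g = t⁻¹ * (t * g) := by group
  generalize s * f = f' at *
  generalize t * g = g' at *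
  subst hef heg
  have central : ∀ {k r : topFullGroup (Fin d → ℤ) Y}, r ∈ swapFullGroup (Fin d → ℤ) Y →
      HasSmallDensity d (3 * (d + 1)) (moved k) → Commute (q r) (q k) := by
    intro k r hr hk
    exact commute_mk_of_mem_swapFullGroup hr (isClopen_moved hfree k).compl.2 hk.exists_notMem
      fun y hy => not_not.1 hy
  -- `h` is invisible modulo three-cycles, since the support of `f'` is not everything; conjugation
  -- by `h` moves that support off the support of `g'`.
  have hconj : q f' = q (h * f' * h⁻¹) := by
    rw [map_mul, map_mul, map_inv, (central hh hf).eq, mul_inv_cancel_right]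
  have hcomm : Commute (q f') (q g') := by
    rw [hconj]
    change q _ * q _ = q _ * q _
    rw [← map_mul, ← map_mul]
    congr 1
    refine topFullGroup_ext fun y => ?_
    have key : ∀ y, y ∈ moved g' → (h * f' * h⁻¹).1 y = y := by
      intro y hy
      change h.1 (f'.1 (h⁻¹.1 y)) = y
      have h1 : h.1 (h⁻¹.1 y) = y := h.1.apply_symm_apply y
      have h2 : f'.1 (h⁻¹.1 y) = h⁻¹.1 y := by
        by_contra hne
        exact hd _ hne (h1.symm ▸ hy)
      rw [h2, h1]
    change (h * f' * h⁻¹).1 (g'.1 y) = g'.1 ((h * f' * h⁻¹).1 y)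
    by_cases hy : y ∈ moved g'
    · rw [key y hy, key]
      exact fun hcon => hy (g'.1.injective hcon)
    · by_cases hy' : (h * f' * h⁻¹).1 y ∈ moved g'
      · have := (h * f' * h⁻¹).1.injective (key _ hy')
        rw [this] at hy'
        exact absurd hy' hy
      · rw [not_not.1 hy, not_not.1 hy']
  rw [← QuotientGroup.eq_one_iff]
  change q _ = 1
  rw [map_commutatorElement, commutatorElement_eq_one_iff_commute, map_mul, map_mul, map_inv,
    map_inv]
  exact ((commute_mk_of_mem_swapFullGroup_of_mem hs ht).inv_inv.mul_right
    (central hs hg).inv_left).mul_left ((central ht hf).symm.inv_right.mul_right hcomm)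

end Density

/-! ### Rules for three-cycles in a subgroup. -/

section CycMem

variable {G Y : Type*} [AddCommGroup G] [AddAction G Y] [TopologicalSpace Y]
  [ContinuousConstVAdd G Y]

/-- The three-cycle on the translates of `U` by `a`, `b`, `c` is defined and belongs to `H`. -/
def CycMem (H : Subgroup (topFullGroup G Y)) (U : Set Y) (a b c : G) : Prop :=
  ∃ (hU : IsClopen U) (h : DisjointTranslates U a b c), threeCycle U a b c hU h ∈ H

variable {H : Subgroup (topFullGroup G Y)} {U V P Q : Set Y} {a b c d e : G}

lemma cycMem_iff_tower {ι : Type*} [Finite ι] [DecidableEq ι] {g : ι → G} (h : IsTower g U)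
    {i j k : ι} (hij : i ≠ j) (hjk : j ≠ k) (hik : i ≠ k) :
    CycMem H U (g i) (g j) (g k) ↔ tower h (swap i j * swap j k) ∈ H := by
  rw [← threeCycle_eq_tower h hij hjk hik h.clopen (disjointTranslates_of_isTower h hij hjk hik)]
  exact ⟨fun ⟨_, _, h⟩ => h, fun h => ⟨_, _, h⟩⟩

lemma CycMem.isTower (h : CycMem H U a b c) : IsTower ![a, b, c] U :=
  isTower_of_disjointTranslates h.1 h.2.1

lemma CycMem.of_tower_mem {ι : Type*} [Finite ι] [DecidableEq ι] {g : ι → G} (h : IsTower g U)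
    {i j k : ι} (hij : i ≠ j) (hjk : j ≠ k) (hik : i ≠ k)
    (hm : tower h (swap i j * swap j k) ∈ H) : CycMem H U (g i) (g j) (g k) :=
  (cycMem_iff_tower h hij hjk hik).2 hm

lemma CycMem.rotate (h : CycMem H U a b c) : CycMem H U b c a := by
  have h1 := (cycMem_iff_tower h.isTower (i := 0) (j := 1) (k := 2) (by decide) (by decide)
    (by decide)).1 h
  refine CycMem.of_tower_mem h.isTower (i := 1) (j := 2) (k := 0) (by decide) (by decide)
    (by decide) ?_
  have : (swap 1 2 * swap 2 0 : Perm (Fin 3)) = swap 0 1 * swap 1 2 := by decide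
  rwa [this]

lemma CycMem.reverse (h : CycMem H U a b c) : CycMem H U c b a := by
  have h1 := (cycMem_iff_tower h.isTower (i := 0) (j := 1) (k := 2) (by decide) (by decide)
    (by decide)).1 h
  refine CycMem.of_tower_mem h.isTower (i := 2) (j := 1) (k := 0) (by decide) (by decide)
    (by decide) ?_
  have : (swap 2 1 * swap 1 0 : Perm (Fin 3)) = (swap 0 1 * swap 1 2)⁻¹ := by decide
  rw [this, map_inv]
  exact inv_mem h1

lemma CycMem.swap_right (h : CycMem H U a b c) : CycMem H U a c b :=
  h.reverse.rotate.rotate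

lemma CycMem.of_vadd {g : G} (h : CycMem H (g +ᵥ U) a b c) :
    CycMem H U (a + g) (b + g) (c + g) := by
  classical
  obtain ⟨hU, hd, hm⟩ := h
  have hU' : IsClopen U := by simpa using isClopen_translate hU (-g)
  have hd' : DisjointTranslates U (a + g) (b + g) (c + g) := by
    simpa only [DisjointTranslates, vadd_vadd] using hd
  refine ⟨hU', hd', ?_⟩
  convert hm using 1
  refine topFullGroup_ext fun y => ?_
  change cycleFun _ _ _ _ y = cycleFun _ _ _ _ y
  have e : ∀ x : G, x +ᵥ (g +ᵥ U) = (x + g) +ᵥ U := fun x => vadd_vadd x g U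
  simp only [cycleFun, cycleCocycle, add_sub_add_right_eq_sub]
  exact congrArg (· +ᵥ y) (if_congr (by rw [e]) rfl (if_congr (by rw [e]) rfl
    (if_congr (by rw [e]) rfl rfl)))

/-- The cycle is the quotient of the two given ones in the symmetric group of four levels. It covers
the case of two shared levels, where `CycMem.inter` does not apply. -/
lemma CycMem.share_two (h1 : CycMem H U a b c) (h2 : CycMem H U a b d)
    (hT : IsTower ![a, b, c, d] U) : CycMem H U a c d := by
  have m1 := (cycMem_iff_tower hT (i := 0) (j := 1) (k := 2) (by decide) (by decide)
    (by decide)).1 h1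
  have m2 := (cycMem_iff_tower hT (i := 0) (j := 1) (k := 3) (by decide) (by decide)
    (by decide)).1 h2
  refine CycMem.of_tower_mem hT (i := 0) (j := 2) (k := 3) (by decide) (by decide)
    (by decide) ?_
  have : (swap 0 2 * swap 2 3 : Perm (Fin 4)) =
      (swap 0 1 * swap 1 3) * (swap 0 1 * swap 1 2)⁻¹ := by decide
  rw [this, map_mul, map_inv]
  exact mul_mem m2 (inv_mem m1)

/-- The commutator of two three-cycles whose supports only meet in one level each is a three-cycle
over the intersection of the bases. -/
lemma CycMem.inter (h1 : CycMem H P a b c) (h2 : CycMem H Q a d e)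
    (hx : ∀ p ∈ P, ∀ q ∈ Q, ∀ s ∈ ({a, b, c} : Set G), ∀ t ∈ ({a, d, e} : Set G),
      s ≠ a ∨ t ≠ a → s +ᵥ p ≠ t +ᵥ q) : CycMem H (P ∩ Q) a b d := by
  -- A common point of the bases is needed to conclude that the group elements are distinct from
  -- `a`; over the empty base the cycle is trivial.
  by_cases hne : (P ∩ Q).Nonempty
  swap
  · rw [Set.not_nonempty_iff_eq_empty] at hne
    rw [hne]
    refine ⟨isClopen_empty, by simp [DisjointTranslates], ?_⟩
    convert H.one_mem
    exact topFullGroup_ext fun y => cycleFun_of_notMem (by simp) (by simp) (by simp)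
  have hP := h1.isTower
  have hQ := h2.isTower
  have m1 := (cycMem_iff_tower hP (i := 0) (j := 1) (k := 2) (by decide) (by decide)
    (by decide)).1 h1
  have m2 := (cycMem_iff_tower hQ (i := 0) (j := 1) (k := 2) (by decide) (by decide)
    (by decide)).1 h2
  obtain ⟨v₀, hv₀P, hv₀Q⟩ := hne
  have hba : b ≠ a := fun h => by simpa using hP.index_eq 1 0 v₀ hv₀P v₀ hv₀P (by simp [h])
  have hca : c ≠ a := fun h => by simpa using hP.index_eq 2 0 v₀ hv₀P v₀ hv₀P (by simp [h])
  have hda : d ≠ a := fun h => by simpa using hQ.index_eq 1 0 v₀ hv₀Q v₀ hv₀Q (by simp [h])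
  have hea : e ≠ a := fun h => by simpa using hQ.index_eq 2 0 v₀ hv₀Q v₀ hv₀Q (by simp [h])
  set p := tower hP (swap 0 1 * swap 1 2) with hp
  have hpa : ∀ v ∈ P, p.1 (a +ᵥ v) = b +ᵥ v := fun v hv => by
    have h01 : (swap 0 1 * swap 1 2 : Perm (Fin 3)) 0 = 1 := by decide
    have := tower_vadd hP (swap 0 1 * swap 1 2) 0 hv
    rw [h01] at this
    exact this
  have hpfix : ∀ y, y ∉ a +ᵥ P → y ∉ b +ᵥ P → y ∉ c +ᵥ P → p.1 y = y := by
    intro y h1 h2 h3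
    refine tower_of_notMem hP _ fun i => ?_
    fin_cases i <;> simpa
  have hpQ : ∀ q ∈ Q, ∀ t ∈ ({d, e} : Set G), p.1 (t +ᵥ q) = t +ᵥ q := by
    intro q hq t ht
    have hta : t ≠ a := by rcases ht with rfl | rfl <;> assumption
    have ht' : t ∈ ({a, d, e} : Set G) := Or.inr ht
    refine hpfix _ ?_ ?_ ?_
    · rintro ⟨p', hp', h⟩
      exact hx p' hp' q hq a (by simp) t ht' (Or.inr hta) h
    · rintro ⟨p', hp', h⟩
      exact hx p' hp' q hq b (by simp) t ht' (Or.inr hta) h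
    · rintro ⟨p', hp', h⟩
      exact hx p' hp' q hq c (by simp) t ht' (Or.inr hta) h
  have hpa' : ∀ q ∈ Q \ P, p.1 (a +ᵥ q) = a +ᵥ q := by
    rintro q ⟨hq, hqP⟩
    refine hpfix _ ?_ ?_ ?_
    · rintro ⟨p', hp', h⟩
      have : p' = q := AddAction.injective a h
      exact hqP (this ▸ hp')
    · rintro ⟨p', hp', h⟩
      exact hx p' hp' q hq b (by simp) a (by simp) (Or.inl hba) h
    · rintro ⟨p', hp', h⟩
      exact hx p' hp' q hq c (by simp) a (by simp) (Or.inl hca) h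
  have hV : IsClopen (P ∩ Q) := hP.clopen.inter hQ.clopen
  have hD : IsClopen (Q \ P) := hQ.clopen.diff hP.clopen
  have hQV : IsTower ![a, d, e] (P ∩ Q) := hQ.mono hV Set.inter_subset_right
  have hQD : IsTower ![a, d, e] (Q \ P) := hQ.mono hD Set.sdiff_subset
  have hf : ∀ i, ∀ v ∈ P ∩ Q, p.1 (![a, d, e] i +ᵥ v) = ![b, d, e] i +ᵥ v := by
    intro i v hv
    fin_cases i
    · exact hpa v hv.1
    · exact hpQ v hv.2 d (by simp)
    · exact hpQ v hv.2 e (by simp)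
  have hf' : ∀ i, ∀ v ∈ Q \ P, p.1 (![a, d, e] i +ᵥ v) = ![a, d, e] i +ᵥ v := by
    intro i v hv
    fin_cases i
    · exact hpa' v hv
    · exact hpQ v hv.1 d (by simp)
    · exact hpQ v hv.1 e (by simp)
  have hbT : IsTower ![b, d, e] (P ∩ Q) := isTower_of_conj hQV p hf
  have hT : IsTower ![a, b, d, e] (P ∩ Q) := by
    refine ⟨hV, fun i j x hx' y hy hxy => ?_⟩
    have hab : ∀ x ∈ P ∩ Q, ∀ y ∈ P ∩ Q, a +ᵥ x ≠ b +ᵥ y := fun x hx' y hy h => by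
      simpa using hP.index_eq 0 1 x hx'.1 y hy.1 h
    have h3 : ∀ k l, (![a, d, e] k +ᵥ x = ![a, d, e] l +ᵥ y) → k = l :=
      fun k l h => hQV.index_eq k l x hx' y hy h
    have h4 : ∀ k l, (![b, d, e] k +ᵥ x = ![b, d, e] l +ᵥ y) → k = l :=
      fun k l h => hbT.index_eq k l x hx' y hy h
    fin_cases i <;> fin_cases j <;> simp at hxy ⊢
    · exact hab x hx' y hy hxy
    · simpa using h3 0 1 hxy
    · simpa using h3 0 2 hxy
    · exact hab y hy x hx' hxy.symm
    · simpa using h4 0 1 hxy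
    · simpa using h4 0 2 hxy
    · simpa using h3 1 0 hxy
    · simpa using h4 1 0 hxy
    · simpa using h4 1 2 hxy
    · simpa using h3 2 0 hxy
    · simpa using h4 2 0 hxy
    · simpa using h4 2 1 hxy
  have hdec : Q = (P ∩ Q) ∪ (Q \ P) := by
    rw [Set.inter_comm, Set.inter_union_sdiff]
  have hQ' : IsTower ![a, d, e] ((P ∩ Q) ∪ (Q \ P)) := hdec ▸ hQ
  have hdisj : Disjoint (P ∩ Q) (Q \ P) := Set.disjoint_left.2 fun x h h' => h'.2 h.1
  have hq : tower hQ (swap 0 1 * swap 1 2) =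
      tower hQV (swap 0 1 * swap 1 2) * tower hQD (swap 0 1 * swap 1 2) := by
    rw [tower_congr hQ hQ' rfl hdec, tower_union hQ' hQV hQD hdisj]
  have hqc : p * tower hQ (swap 0 1 * swap 1 2) * p⁻¹ =
      tower hbT (swap 0 1 * swap 1 2) * tower hQD (swap 0 1 * swap 1 2) := by
    rw [← conj_tower hQV hbT _ p hf, ← conj_tower hQD hQD _ p hf', hq]
    group
  -- Conjugation by `p` turns (a d e) into (b d e) over `P ∩ Q` and changes nothing over `Q \ P`.
  -- The latter part cancels in the commutator, leaving (b d e)(a d e)⁻¹ = (a b d).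
  have hmem : tower hbT (swap 0 1 * swap 1 2) * (tower hQV (swap 0 1 * swap 1 2))⁻¹ ∈ H := by
    have : tower hbT (swap 0 1 * swap 1 2) * (tower hQV (swap 0 1 * swap 1 2))⁻¹ =
        (p * tower hQ (swap 0 1 * swap 1 2) * p⁻¹) * (tower hQ (swap 0 1 * swap 1 2))⁻¹ := by
      rw [hqc, hq]
      group
    rw [this]
    exact mul_mem (mul_mem (mul_mem m1 m2) (inv_mem m1)) (inv_mem m2)
  have e1 : tower hbT (swap 0 1 * swap 1 2) = tower hT (swap 1 2 * swap 2 3) := by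
    rw [← threeCycle_eq_tower hbT (a := 0) (b := 1) (c := 2) (by decide) (by decide) (by decide)
      hV (disjointTranslates_of_isTower hbT (by decide) (by decide) (by decide))]
    exact threeCycle_eq_tower hT (a := 1) (b := 2) (c := 3) (by decide) (by decide) (by decide)
      hV (disjointTranslates_of_isTower hT (by decide) (by decide) (by decide))
  have e2 : tower hQV (swap 0 1 * swap 1 2) = tower hT (swap 0 2 * swap 2 3) := by
    rw [← threeCycle_eq_tower hQV (a := 0) (b := 1) (c := 2) (by decide) (by decide) (by decide)
      hV (disjointTranslates_of_isTower hQV (by decide) (by decide) (by decide))]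
    exact threeCycle_eq_tower hT (a := 0) (b := 2) (c := 3) (by decide) (by decide) (by decide)
      hV (disjointTranslates_of_isTower hT (by decide) (by decide) (by decide))
  refine CycMem.of_tower_mem hT (i := 0) (j := 1) (k := 2) (by decide) (by decide)
    (by decide) ?_
  have e3 : (swap 0 1 * swap 1 2 : Perm (Fin 4)) =
      (swap 1 2 * swap 2 3) * (swap 0 2 * swap 2 3)⁻¹ := by decide
  rw [e3, map_mul, map_inv, ← e1, ← e2]
  exact hmem

/-- Three-cycles may be restricted to the complement of a smaller base. -/
lemma CycMem.of_sdiff (h1 : CycMem H P a b c) (hV : IsClopen V) (hVP : V ⊆ P)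
    (h2 : CycMem H (P \ V) a b c) : CycMem H V a b c := by
  have hP := h1.isTower
  have hD := h2.isTower
  have hT : IsTower ![a, b, c] V := hP.mono hV hVP
  have hdec : P = V ∪ (P \ V) := by rw [Set.union_sdiff_cancel hVP]
  have hP' : IsTower ![a, b, c] (V ∪ (P \ V)) := hdec ▸ hP
  have m1 := (cycMem_iff_tower hP (i := 0) (j := 1) (k := 2) (by decide) (by decide)
    (by decide)).1 h1
  have m2 := (cycMem_iff_tower hD (i := 0) (j := 1) (k := 2) (by decide) (by decide)
    (by decide)).1 h2
  refine CycMem.of_tower_mem hT (i := 0) (j := 1) (k := 2) (by decide) (by decide)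
    (by decide) ?_
  rw [tower_congr hP hP' rfl hdec, tower_union hP' hT hD Set.disjoint_sdiff_right] at m1
  exact (Subgroup.mul_mem_cancel_right H m2).1 m1

/-- Membership of a three-cycle can be checked on the pieces of a finite clopen partition. -/
lemma CycMem.of_partition {F : Type*} [Finite F] {κ : Y → F} (hκ : IsLocallyConstant κ)
    (hU : IsClopen U) (hd : DisjointTranslates U a b c)
    (h : ∀ y ∈ U, CycMem H (U ∩ κ ⁻¹' {κ y}) a b c) : CycMem H U a b c := by
  classical
  have hT := isTower_of_disjointTranslates hU hd
  have hcl : ∀ S : Set F, IsClopen (U ∩ κ ⁻¹' S) := fun S => hU.inter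
    ⟨isOpen_compl_iff.1 (hκ Sᶜ), hκ S⟩
  have key : ∀ S : Set F, S.Finite →
      ∀ hS : IsTower ![a, b, c] (U ∩ κ ⁻¹' S), tower hS (swap 0 1 * swap 1 2) ∈ H := by
    intro S hS
    induction S, hS using Set.Finite.induction_on with
    | empty =>
      intro hS
      have : U ∩ κ ⁻¹' ∅ = ∅ := by simp
      rw [tower_congr hS (this ▸ hS) rfl this, tower_empty]
      exact one_mem _
    | @insert x S hx _ ih =>
      intro hS
      have e : U ∩ κ ⁻¹' (insert x S) = (U ∩ κ ⁻¹' {x}) ∪ (U ∩ κ ⁻¹' S) := by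
        rw [← Set.inter_union_distrib_left, ← Set.preimage_union, Set.singleton_union]
      have t1 : IsTower ![a, b, c] (U ∩ κ ⁻¹' {x}) := hT.mono (hcl _) Set.inter_subset_left
      have t2 : IsTower ![a, b, c] (U ∩ κ ⁻¹' S) := hT.mono (hcl _) Set.inter_subset_left
      have hdj : Disjoint (U ∩ κ ⁻¹' {x}) (U ∩ κ ⁻¹' S) := by
        rw [Set.disjoint_left]
        rintro y ⟨-, hy⟩ ⟨-, hy'⟩
        rw [Set.mem_preimage, Set.mem_singleton_iff] at hy
        rw [Set.mem_preimage, hy] at hy'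
        exact hx hy'
      rw [tower_congr hS (e ▸ hS) rfl e, tower_union (e ▸ hS) t1 t2 hdj]
      refine mul_mem ?_ (ih t2)
      by_cases hne : (U ∩ κ ⁻¹' {x}).Nonempty
      · obtain ⟨y, hyU, rfl⟩ := hne
        exact (cycMem_iff_tower t1 (i := 0) (j := 1) (k := 2) (by decide) (by decide)
          (by decide)).1 (h y hyU)
      · rw [Set.not_nonempty_iff_eq_empty] at hne
        rw [tower_congr t1 (hne ▸ t1) rfl hne, tower_empty]
        exact one_mem _
  have e : U ∩ κ ⁻¹' Set.univ = U := by simp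
  refine CycMem.of_tower_mem hT (i := 0) (j := 1) (k := 2) (by decide) (by decide)
    (by decide) ?_
  rw [tower_congr hT (e.symm ▸ hT) rfl e.symm]
  exact key _ Set.finite_univ _

end CycMem

/-- A symmetric ternary relation that is closed under the two exchange rules of three-cycles
contains every triple whose consecutive members are linked. -/
lemma ternary_of_linked {α : Type*} {R : α → α → α → Prop}
    (rot : ∀ {a b c}, R a b c → R b c a) (flip : ∀ {a b c}, R a b c → R a c b)
    (two : ∀ {a b c d}, R a b c → R a b d → c ≠ d → R a c d)
    (one : ∀ {a b c d e}, R a b c → R a d e → b ≠ d → b ≠ e → c ≠ d → c ≠ e → R a b d)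
    {a b c d e : α} (h1 : R a b c) (h2 : R b d e) (had : a ≠ d) : R a b d := by
  have h1' : R b a c := flip (rot h1)
  -- With pivot `b`, the pairs {a, c} and {d, e} either share an element, which gives the result at
  -- once or by the rule `two`, or are disjoint, which is the case of the commutator rule `one`.
  by_cases hcd : c = d
  · exact hcd ▸ h1
  by_cases hea : e = a
  · exact rot (rot (hea ▸ h2))
  by_cases hce : c = e
  · subst hce
    exact flip (rot (two (flip h1') (flip h2) had))
  · exact flip (rot (one h1' h2 had (Ne.symm hea) hcd hce))

/-! ### The word length on ℤ^d. -/

section Len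

variable {d : ℕ}

lemma len_add_le (a b : Fin d → ℤ) : len (a + b) ≤ len a + len b := by
  simp only [len, ← Finset.sum_add_distrib]
  exact Finset.sum_le_sum fun i _ => Int.natAbs_add_le _ _

lemma len_neg (a : Fin d → ℤ) : len (-a) = len a := by
  simp [len]

lemma len_sub_le (a b : Fin d → ℤ) : len (a - b) ≤ len a + len b := by
  rw [sub_eq_add_neg, ← len_neg b]
  exact len_add_le _ _

lemma len_zero : len (0 : Fin d → ℤ) = 0 := by simp [len]

lemma len_single (i : Fin d) (n : ℤ) : len (Pi.single i n : Fin d → ℤ) = n.natAbs := by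
  rw [len, Finset.sum_eq_single i]
  · simp
  · intro j _ hj
    simp [Pi.single_eq_of_ne hj]
  · simp

/-- Every non-zero vector has a neighbour that is closer to `0`. -/
lemma exists_len_sub_single {i : Fin d → ℤ} (hi : i ≠ 0) :
    ∃ j, ∃ e : Fin d → ℤ, (e = Pi.single j 1 ∨ e = -Pi.single j 1) ∧ len (i - e) + 1 = len i := by
  obtain ⟨j, hj⟩ := Function.ne_iff.1 hi
  have key : ∀ e : Fin d → ℤ, (∀ k ≠ j, e k = 0) → (i j - e j).natAbs + 1 = (i j).natAbs →
      len (i - e) + 1 = len i := by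
    intro e he hej
    simp only [len]
    rw [← Finset.add_sum_erase _ _ (Finset.mem_univ j),
      ← Finset.add_sum_erase _ (fun k => (i k).natAbs) (Finset.mem_univ j)]
    have : ∑ x ∈ Finset.univ.erase j, ((i - e) x).natAbs =
        ∑ x ∈ Finset.univ.erase j, (i x).natAbs := by
      refine Finset.sum_congr rfl fun k hk => ?_
      rw [Pi.sub_apply, he k (Finset.ne_of_mem_erase hk), sub_zero]
    rw [this, Pi.sub_apply]
    omega
  rw [Pi.zero_apply] at hj
  rcases lt_or_gt_of_ne hj with h | h
  · refine ⟨j, -Pi.single j 1, Or.inr rfl, key _ (fun k hk => ?_) ?_⟩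
    · simp [Pi.single_eq_of_ne hk]
    · simp only [Pi.neg_apply, Pi.single_eq_same]
      omega
  · refine ⟨j, Pi.single j 1, Or.inl rfl, key _ (fun k hk => ?_) ?_⟩
    · simp [Pi.single_eq_of_ne hk]
    · simp only [Pi.single_eq_same]
      omega

end Len

/-! ### Patches as a basis of clopen sets, and the separating radius. -/

section Patch

variable {d : ℕ} {X Y : Type*} [TopologicalSpace X] [DiscreteTopology X]
  [TopologicalSpace Y] [AddAction (Fin d → ℤ) Y] {C : Subshift X (Fin d → ℤ)} (φ : Y ≃ₜ C.carrier)

/-- The points of `Y` whose configurations agree with the one of `z` on the ball of radius `R`. -/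
def patch (R : ℕ) (z : Y) : Set Y := patchSet φ (ball d R) (φ z)

variable {φ}

lemma mem_patch {R : ℕ} {y z : Y} :
    y ∈ patch φ R z ↔ ∀ i, len i ≤ R → (φ y).1 i = (φ z).1 i := by
  simp only [patch, patchSet, Set.mem_ofPred_eq, mem_cylinder, mem_ball]

lemma isClopen_patch (R : ℕ) (z : Y) : IsClopen (patch φ R z) := isClopen_patchSet φ _ _

lemma self_mem_patch (R : ℕ) (z : Y) : z ∈ patch φ R z := mem_patch.2 fun _ _ => rfl

lemma patch_eq_of_mem {R : ℕ} {y z : Y} (h : y ∈ patch φ R z) : patch φ R y = patch φ R z := by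
  rw [mem_patch] at h
  ext x
  rw [mem_patch, mem_patch]
  exact forall₂_congr fun i hi => by rw [h i hi]

lemma patch_anti {R R' : ℕ} (h : R ≤ R') (z : Y) : patch φ R' z ⊆ patch φ R z := fun _ hy =>
  mem_patch.2 fun i hi => mem_patch.1 hy i (hi.trans h)

variable (φ) in
lemma exists_patch_subset {U : Set Y} (hU : IsOpen U) {y : Y} (hy : y ∈ U) :
    ∃ R, patch φ R y ⊆ U := by
  have h1 : IsOpen (φ.symm ⁻¹' U) := hU.preimage φ.symm.continuous
  obtain ⟨W, hW, hWU⟩ := isOpen_induced_iff.1 h1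
  have hyW : (φ y).1 ∈ W := by
    have : φ y ∈ Subtype.val ⁻¹' W := by
      rw [hWU]
      simpa using hy
    exact this
  obtain ⟨I, u, hu, hIW⟩ := isOpen_pi_iff.1 hW _ hyW
  refine ⟨I.sup len, fun x hx => ?_⟩
  have hxW : φ x ∈ Subtype.val ⁻¹' W := by
    refine hIW fun i hi => ?_
    rw [mem_patch.1 hx i (Finset.le_sup (f := len) hi)]
    exact (hu i hi).2
  rw [hWU] at hxW
  simpa using hxW

variable (φ) in
/-- A compactness principle: a condition that holds locally for some radius and is monotone in the
radius holds everywhere for one radius. -/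
lemma exists_uniform_radius [CompactSpace Y] (Φ : ℕ → Y → Prop)
    (mono : ∀ {R R' z}, Φ R z → R ≤ R' → Φ R' z) (loc : ∀ y, ∃ R, ∀ z ∈ patch φ R y, Φ R z) :
    ∃ R, ∀ z, Φ R z := by
  have := (isCompact_univ (X := Y)).induction_on (p := fun s => ∃ R, ∀ z ∈ s, Φ R z)
    ⟨0, by simp⟩ (fun s t hst ⟨R, hR⟩ => ⟨R, fun z hz => hR z (hst hz)⟩) ?_ ?_
  · obtain ⟨R, hR⟩ := this
    exact ⟨R, fun z => hR z trivial⟩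
  · rintro s t ⟨R, hR⟩ ⟨R', hR'⟩
    refine ⟨max R R', ?_⟩
    rintro z (hz | hz)
    · exact mono (hR z hz) (le_max_left _ _)
    · exact mono (hR' z hz) (le_max_right _ _)
  · intro y _
    obtain ⟨R, hR⟩ := loc y
    exact ⟨patch φ R y, mem_nhdsWithin_of_mem_nhds ((isClopen_patch R y).2.mem_nhds
      (self_mem_patch R y)), R, hR⟩

variable (φ) in
lemma exists_radius_subset [CompactSpace Y] {U : Set Y} (hU : IsClopen U) :
    ∃ R, ∀ z ∈ U, patch φ R z ⊆ U := by
  refine exists_uniform_radius φ (fun R z => z ∈ U → patch φ R z ⊆ U)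
    (fun h hR hz => (patch_anti hR _).trans (h hz)) fun y => ?_
  by_cases hy : y ∈ U
  · obtain ⟨R, hR⟩ := exists_patch_subset φ hU.2 hy
    exact ⟨R, fun z hz _ => (patch_eq_of_mem hz) ▸ hR⟩
  · obtain ⟨R, hR⟩ := exists_patch_subset φ hU.compl.2 hy
    exact ⟨R, fun z hz hzU => absurd hzU (hR hz)⟩

variable (hφ : ∀ (g : Fin d → ℤ) (y : Y), (φ (g +ᵥ y) : (Fin d → ℤ) → X) = translate g (φ y))

include hφ in
lemma apply_vadd (g : Fin d → ℤ) (y : Y) (i : Fin d → ℤ) :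
    (φ (g +ᵥ y)).1 i = (φ y).1 (i - g) := by
  have h := congrFun (hφ g y) i
  exact h

-- In `Y`, incompatibility of a patch with its translate by `g` means that the clopen set of the
-- patch is disjoint from its translate by `g`.
include hφ in
lemma isSeparatingRadius_iff {R : ℕ} : IsSeparatingRadius C R ↔
    ∀ z y : Y, ∀ g : Fin d → ℤ, g ≠ 0 → len g ≤ 3 → y ∈ patch φ R z → g +ᵥ y ∉ patch φ R z := by
  have aux : ∀ (z y : Y) (g : Fin d → ℤ),
      (φ (g +ᵥ y)).1 ∈ cylinder ((ball d R).image fun h => h + g) (translate g (φ z)) ↔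
      y ∈ patch φ R z := by
    intro z y g
    rw [mem_patch, mem_cylinder]
    simp only [Finset.mem_image, mem_ball, forall_exists_index, and_imp,
      forall_apply_eq_imp_iff₂, apply_vadd hφ, translate, add_sub_cancel_right]
  constructor
  · intro h z y g hg hlen hy hgy
    exact h (φ z) (φ z).2 g hg hlen ⟨φ (g +ᵥ y), (φ _).2, hgy, (aux z y g).2 hy⟩
  · rintro h w hw g hg hlen ⟨u, hu, h1, h2⟩
    obtain ⟨z, hz⟩ := φ.surjective ⟨w, hw⟩
    obtain ⟨x, hx⟩ := φ.surjective ⟨u, hu⟩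
    obtain rfl : (φ z).1 = w := by rw [hz]
    obtain rfl : (φ x).1 = u := by rw [hx]
    have e : g +ᵥ (-g +ᵥ x) = x := vadd_neg_vadd g x
    refine h z (-g +ᵥ x) g hg hlen ((aux z _ g).1 (by rwa [e])) ?_
    rw [e]
    exact h1

-- By freeness the translates of a point by vectors of length at most 3 are distinct, so a small
-- patch around it is a tower base. Compactness makes the radius uniform.
include hφ in
lemma exists_isSeparatingRadius [ContinuousConstVAdd (Fin d → ℤ) Y] [CompactSpace Y] [T2Space Y]
    [TotallyDisconnectedSpace Y] (hfree : ∀ (g : Fin d → ℤ) (y : Y), g +ᵥ y = y → g = 0) :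
    ∃ R, IsSeparatingRadius C R := by
  simp only [isSeparatingRadius_iff hφ]
  have := exists_uniform_radius φ (fun R z => ∀ y : Y, ∀ g : Fin d → ℤ, g ≠ 0 → len g ≤ 3 →
    y ∈ patch φ R z → g +ᵥ y ∉ patch φ R z) ?_ ?_
  · obtain ⟨R, hR⟩ := this
    exact ⟨R, hR⟩
  · intro R R' z h hR y g hg hlen hy hgy
    exact h y g hg hlen (patch_anti hR z hy) (patch_anti hR z hgy)
  · intro y
    have hinj : Function.Injective fun g : ball d 3 => g.1 +ᵥ y := by
      intro g h hgh
      have h1 : (-h.1 + g.1) +ᵥ y = y := by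
        rw [add_vadd]
        change -h.1 +ᵥ ((fun g : ball d 3 => g.1 +ᵥ y) g) = y
        rw [hgh]
        exact neg_vadd_vadd _ _
      have h2 := hfree _ _ h1
      rw [neg_add_eq_zero] at h2
      exact Subtype.ext h2.symm
    obtain ⟨N, hyN, hN⟩ := exists_isTower hinj
    obtain ⟨R, hR⟩ := exists_patch_subset φ hN.clopen.2 hyN
    refine ⟨R, fun z hz x g hg hlen hx hgx => ?_⟩
    rw [patch_eq_of_mem hz] at hx hgx
    have h0 : (0 : Fin d → ℤ) ∈ ball d 3 := by rw [mem_ball, len_zero]; omega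
    have := hN.index_eq ⟨g, mem_ball.2 hlen⟩ ⟨0, h0⟩ x (hR hx) (g +ᵥ x) (hR hgx) (by simp)
    exact hg (congrArg Subtype.val this)

lemma finite_cycleSet [Finite X] [ContinuousConstVAdd (Fin d → ℤ) Y] (R : ℕ) :
    (cycleSet φ R).Finite := by
  classical
  have hfin : (Set.range fun w : (Fin d → ℤ) → X => patchSet φ (ball d R) w).Finite := by
    have : (Set.range fun p : ball d R → X =>
        {y | ∀ i : ball d R, (φ y).1 i = p i}).Finite := Set.finite_range _
    refine this.subset ?_
    rintro _ ⟨w, rfl⟩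
    refine ⟨fun i => w i, ?_⟩
    ext y
    simp [patchSet, mem_cylinder]
  have hfin2 := hfin.prod (Set.finite_univ (α := Fin d))
  refine (hfin2.image fun p => if h : ∃ (hU : IsClopen p.1)
    (h : DisjointTranslates p.1 (0 : Fin d → ℤ) (Pi.single p.2 1) (-Pi.single p.2 1)), True then
      threeCycle p.1 0 (Pi.single p.2 1) (-Pi.single p.2 1) h.choose h.choose_spec.choose
      else 1).subset ?_
  rintro _ ⟨w, hw, i, h, rfl⟩
  refine ⟨(patchSet φ (ball d R) w, i), ⟨⟨w, rfl⟩, trivial⟩, ?_⟩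
  exact dif_pos ⟨isClopen_patchSet φ _ w, h, trivial⟩

end Patch

/-! ### Separated bases and the intersection of neighbouring patches. -/

section Separated

variable {d : ℕ} {Y : Type*} [TopologicalSpace Y] [AddAction (Fin d → ℤ) Y]

/-- A set that is disjoint from its translates by the non-zero vectors of length at most `3`. -/
def IsSeparated (d : ℕ) {Y : Type*} [AddAction (Fin d → ℤ) Y] (Z : Set Y) : Prop :=
  ∀ g : Fin d → ℤ, g ≠ 0 → len g ≤ 3 → ∀ y ∈ Z, g +ᵥ y ∉ Z

lemma IsSeparated.vadd_ne {Z : Set Y} (hZ : IsSeparated d Z) {s t : Fin d → ℤ} (hst : s ≠ t)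
    (hlen : len (s - t) ≤ 3) {p q : Y} (hp : p ∈ Z) (hq : q ∈ Z) : s +ᵥ p ≠ t +ᵥ q := by
  intro h
  refine hZ (s - t) (sub_ne_zero.2 hst) hlen p hp ?_
  have : (s - t) +ᵥ p = q := by
    rw [sub_eq_neg_add, add_vadd, h, neg_vadd_vadd]
  rwa [this]

lemma IsSeparated.isTower {Z U : Set Y} (hZ : IsSeparated d Z) (hU : IsClopen U) (hUZ : U ⊆ Z)
    {ι : Type*} {g : ι → Fin d → ℤ} (hg : Function.Injective g)
    (hlen : ∀ i j, len (g i - g j) ≤ 3) : IsTower g U := by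
  refine ⟨hU, fun i j u hu v hv huv => ?_⟩
  by_contra hij
  exact hZ.vadd_ne (hg.ne hij) (hlen i j) (hUZ hu) (hUZ hv) huv

lemma IsSeparated.isTower_four {Z U : Set Y} (hZ : IsSeparated d Z) (hU : IsClopen U)
    (hUZ : U ⊆ Z) {b c e : Fin d → ℤ} (hb : len b ≤ 1) (hc : len c ≤ 1) (he : len e ≤ 1)
    (hb0 : b ≠ 0) (hc0 : c ≠ 0) (he0 : e ≠ 0) (hbc : b ≠ c) (hbe : b ≠ e) (hce : c ≠ e) :
    IsTower ![0, b, c, e] U := by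
  refine hZ.isTower hU hUZ ?_ ?_
  · intro i j hij
    fin_cases i <;> fin_cases j <;> simp at hij ⊢
    all_goals first
      | exact absurd hij ‹_›
      | exact absurd hij.symm ‹_›
  · have key : ∀ i, len ((![0, b, c, e] : Fin 4 → Fin d → ℤ) i) ≤ 1 := by
      intro i
      fin_cases i
      · exact (len_zero (d := d)).le.trans (by omega)
      · exact hb
      · exact hc
      · exact he
    intro i j
    have := len_sub_le ((![0, b, c, e] : Fin 4 → Fin d → ℤ) i) ((![0, b, c, e] : Fin 4 → _) j)
    have := key i
    have := key j
    omega

lemma single_one_ne_zero (k : Fin d) : (Pi.single k 1 : Fin d → ℤ) ≠ 0 := by simp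

lemma single_one_ne_neg (k : Fin d) : (Pi.single k 1 : Fin d → ℤ) ≠ -Pi.single k 1 := fun h => by
  have := congrFun h k
  simp at this

variable [ContinuousConstVAdd (Fin d → ℤ) Y] {H : Subgroup (topFullGroup (Fin d → ℤ) Y)}

lemma IsSeparated.disjointTranslates {Z U : Set Y} (hZ : IsSeparated d Z) (hU : IsClopen U)
    (hUZ : U ⊆ Z) (k : Fin d) :
    DisjointTranslates U (0 : Fin d → ℤ) (Pi.single k 1) (-Pi.single k 1) := by
  have hT : IsTower ![(0 : Fin d → ℤ), Pi.single k 1, -Pi.single k 1] U := by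
    refine hZ.isTower hU hUZ ?_ ?_
    · have h1 := single_one_ne_zero k
      have h2 := single_one_ne_neg k
      have h3 : -(Pi.single k 1 : Fin d → ℤ) ≠ 0 := by simp
      intro i j hij
      fin_cases i <;> fin_cases j <;> simp at hij ⊢
      all_goals first
        | exact h1 hij
        | exact h1 hij.symm
        | exact h2 hij
        | exact h2 hij.symm
    · have key : ∀ i, len ((![0, Pi.single k 1, -Pi.single k 1] : Fin 3 → Fin d → ℤ) i) ≤ 1 := by
        intro i
        fin_cases i
        · exact (len_zero (d := d)).le.trans (by omega)
        · exact (len_single k 1).le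
        · exact (len_neg (Pi.single k 1)).le.trans (len_single k 1).le
      intro i j
      have := len_sub_le ((![0, Pi.single k 1, -Pi.single k 1] : Fin 3 → Fin d → ℤ) i)
        ((![0, Pi.single k 1, -Pi.single k 1] : Fin 3 → _) j)
      have := key i
      have := key j
      omega
  exact disjointTranslates_of_isTower hT (a := 0) (b := 1) (c := 2) (by decide) (by decide)
    (by decide)

/-- Levels at lengths at most 1 and at most 2 differ by length at most 3. This is where the bound 3
in the separation condition is needed. -/
lemma CycMem.inter_of_isSeparated {Z P Q : Set Y} (hZ : IsSeparated d Z) (hP : P ⊆ Z) (hQ : Q ⊆ Z)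
    {b c g e : Fin d → ℤ} (h1 : CycMem H P 0 b c) (h2 : CycMem H Q 0 g e)
    (hb : len b ≤ 1) (hc : len c ≤ 1) (hg : len g ≤ 2) (he : len e ≤ 2)
    (hb0 : b ≠ 0) (hc0 : c ≠ 0) (hg0 : g ≠ 0) (he0 : e ≠ 0)
    (hbg : b ≠ g) (hbe : b ≠ e) (hcg : c ≠ g) (hce : c ≠ e) :
    CycMem H (P ∩ Q) 0 b g := by
  refine h1.inter h2 fun p hp q hq s hs t ht hst => hZ.vadd_ne ?_ ?_ (hP hp) (hQ hq)
  · rcases hs with rfl | rfl | rfl <;> rcases ht with rfl | rfl | rfl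
    · simp at hst
    all_goals first
      | assumption
      | exact Ne.symm ‹_›
  · have l0 := len_zero (d := d)
    have hs' : len s ≤ 1 := by rcases hs with rfl | rfl | rfl <;> omega
    have ht' : len t ≤ 2 := by rcases ht with rfl | rfl | rfl <;> omega
    have := len_sub_le s t
    omega

lemma len_add_self_single {j : Fin d} {ε : Fin d → ℤ} (hε : ε = Pi.single j 1 ∨ ε = -Pi.single j 1) :
    len ε = 1 ∧ ε ≠ 0 ∧ ε + ε ≠ 0 ∧ ∀ k ≠ j, ε k = 0 := by
  have h1 := single_one_ne_zero j
  have h2 := single_one_ne_neg j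
  have h3 := len_single j 1
  rcases hε with rfl | rfl
  · exact ⟨h3, h1, fun h => h2 (eq_neg_of_add_eq_zero_left h), fun k hk => by simp [hk]⟩
  · exact ⟨(len_neg _).trans h3, by simp, fun h => h2 (by
      have := eq_neg_of_add_eq_zero_left h
      rw [neg_neg] at this
      exact this.symm), fun k hk => by simp [hk]⟩

/-- In dimension at least two, three-cycles along all coordinate directions can be restricted to
the intersection of the base with a neighbouring base. -/
lemma cycMem_inter_direction [Nontrivial (Fin d)] {Z P Q : Set Y} (hZ : IsSeparated d Z)
    (hP : P ⊆ Z) (hQ : Q ⊆ Z)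
    (h1 : ∀ k, CycMem H P (0 : Fin d → ℤ) (Pi.single k 1) (-Pi.single k 1)) {j : Fin d}
    {ε : Fin d → ℤ} (hε : ε = Pi.single j 1 ∨ ε = -Pi.single j 1)
    (h2 : CycMem H Q 0 ε (ε + ε)) (k : Fin d) :
    CycMem H (P ∩ Q) (0 : Fin d → ℤ) (Pi.single k 1) (-Pi.single k 1) := by
  obtain ⟨hε1, hε0, hεε, hεk⟩ := len_add_self_single hε
  have hεε2 : len (ε + ε) ≤ 2 := (len_add_le ε ε).trans (by omega)
  have hlen : ∀ k : Fin d, len (Pi.single k 1 : Fin d → ℤ) ≤ 1 := fun k => (len_single k 1).le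
  have hlen' : ∀ k : Fin d, len (-Pi.single k 1 : Fin d → ℤ) ≤ 1 := fun k => by
    rw [len_neg]
    exact hlen k
  have hne0' : ∀ k : Fin d, (-Pi.single k 1 : Fin d → ℤ) ≠ 0 := fun k => by simp
  have hV : IsClopen (P ∩ Q) := (h1 j).1.inter h2.1
  -- In a direction k ≠ j the vectors ±e_k differ from ε and 2ε, so commutators give (0, e_k, ε) and
  -- (0, -e_k, ε) over the intersection. These share two levels and yield (0, e_k, -e_k).
  have off : ∀ k ≠ j, CycMem H (P ∩ Q) (0 : Fin d → ℤ) (Pi.single k 1) (-Pi.single k 1) := by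
    intro k hk
    have a1 : (Pi.single k 1 : Fin d → ℤ) ≠ ε := fun h => by
      simpa [hεk k hk] using congrFun h k
    have a2 : (Pi.single k 1 : Fin d → ℤ) ≠ ε + ε := fun h => by
      simpa [hεk k hk] using congrFun h k
    have a3 : (-Pi.single k 1 : Fin d → ℤ) ≠ ε := fun h => by
      simpa [hεk k hk] using congrFun h k
    have a4 : (-Pi.single k 1 : Fin d → ℤ) ≠ ε + ε := fun h => by
      simpa [hεk k hk] using congrFun h k
    have c1 := (h1 k).inter_of_isSeparated hZ hP hQ h2 (hlen k) (hlen' k) (by omega) hεε2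
      (single_one_ne_zero k) (hne0' k) hε0 hεε a1 a2 a3 a4
    have c2 := (h1 k).swap_right.inter_of_isSeparated hZ hP hQ h2 (hlen' k) (hlen k) (by omega)
      hεε2 (hne0' k) (single_one_ne_zero k) hε0 hεε a3 a4 a1 a2
    exact c1.swap_right.share_two c2.swap_right (hZ.isTower_four hV
      (Set.inter_subset_left.trans hP) hε1.le (hlen k) (hlen' k) hε0 (single_one_ne_zero k)
      (hne0' k) a1.symm a3.symm (single_one_ne_neg k))
  by_cases hkj : k = j
  · subst hkj
    -- In the direction of ε itself the levels would collide. The cycle just obtained in another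
    -- direction `i` over `P ∩ Q` replaces the one along ε.
    obtain ⟨i, hi⟩ := exists_ne k
    have a1 : (Pi.single k 1 : Fin d → ℤ) ≠ Pi.single i 1 := fun h => by
      simpa [hi] using congrFun h i
    have a2 : (Pi.single k 1 : Fin d → ℤ) ≠ -Pi.single i 1 := fun h => by
      simpa [hi] using congrFun h i
    have a3 : (-Pi.single k 1 : Fin d → ℤ) ≠ Pi.single i 1 := fun h => by
      simpa [hi] using congrFun h i
    have a4 : (-Pi.single k 1 : Fin d → ℤ) ≠ -Pi.single i 1 := fun h => by
      simpa [hi] using congrFun h i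
    have hVZ : P ∩ Q ⊆ Z := Set.inter_subset_left.trans hP
    have e : P ∩ (P ∩ Q) = P ∩ Q := by rw [← Set.inter_assoc, Set.inter_self]
    have c1 := (h1 k).inter_of_isSeparated hZ hP hVZ (off i hi) (hlen k) (hlen' k)
      ((hlen i).trans (by omega)) ((hlen' i).trans (by omega)) (single_one_ne_zero k) (hne0' k)
      (single_one_ne_zero i) (hne0' i) a1 a2 a3 a4
    have c2 := (h1 k).swap_right.inter_of_isSeparated hZ hP hVZ (off i hi) (hlen' k) (hlen k)
      ((hlen i).trans (by omega)) ((hlen' i).trans (by omega)) (hne0' k) (single_one_ne_zero k)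
      (single_one_ne_zero i) (hne0' i) a3 a4 a1 a2
    rw [e] at c1 c2
    exact c1.swap_right.share_two c2.swap_right (hZ.isTower_four hV hVZ (hlen i) (hlen k)
      (hlen' k) (single_one_ne_zero i) (single_one_ne_zero k) (hne0' k) a1.symm a3.symm
      (single_one_ne_neg k))
  · exact off k hkj

end Separated

/-! ### Enlarging the radius of patches in dimension at least two. -/

section Patch

variable {d : ℕ} {X Y : Type*} [TopologicalSpace X] [DiscreteTopology X]
  [TopologicalSpace Y] [AddAction (Fin d → ℤ) Y] {C : Subshift X (Fin d → ℤ)} {φ : Y ≃ₜ C.carrier}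
  (hφ : ∀ (g : Fin d → ℤ) (y : Y), (φ (g +ᵥ y) : (Fin d → ℤ) → X) = translate g (φ y))

include hφ in
lemma neg_vadd_mem_patch {ε : Fin d → ℤ} {R : ℕ} {y z : Y} :
    -ε +ᵥ y ∈ patch φ R (-ε +ᵥ z) ↔ ∀ i, len (i - ε) ≤ R → (φ y).1 i = (φ z).1 i := by
  simp only [mem_patch, apply_vadd hφ, sub_neg_eq_add]
  constructor
  · intro h i hi
    simpa using h (i - ε) hi
  · intro h i hi
    exact h (i + ε) (by simpa using hi)

variable [ContinuousConstVAdd (Fin d → ℤ) Y] {H : Subgroup (topFullGroup (Fin d → ℤ) Y)}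

/-- The set of points that agree with `z` on the ball of radius `R` around `ε`. -/
def shiftedPatch (φ : Y ≃ₜ C.carrier) (R : ℕ) (ε : Fin d → ℤ) (z : Y) : Set Y :=
  (-ε +ᵥ ·) ⁻¹' patch φ R (-ε +ᵥ z)

/-- Moving the base by ε turns the levels 0, ε, -ε into -ε, 0, -2ε. So the same generator, seen from
the recentred patch, is a cycle through 0 on one side only. -/
lemma cycMem_shiftedPatch {R : ℕ} {j : Fin d} {ε : Fin d → ℤ}
    (hε : ε = Pi.single j 1 ∨ ε = -Pi.single j 1) (z : Y)
    (h : ∀ z, CycMem H (patch φ R z) (0 : Fin d → ℤ) (Pi.single j 1) (-Pi.single j 1)) :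
    CycMem H (shiftedPatch φ R ε z) 0 (-ε) (-ε + -ε) := by
  have h' : CycMem H (patch φ R (-ε +ᵥ z)) 0 ε (-ε) := by
    rcases hε with rfl | rfl
    · exact h _
    · rw [neg_neg]
      exact (h _).swap_right
  have e : -ε +ᵥ shiftedPatch φ R ε z = patch φ R (-ε +ᵥ z) := by
    ext y
    rw [Set.mem_vadd_set_iff_neg_vadd_mem, shiftedPatch, Set.mem_preimage, vadd_vadd, neg_neg,
      neg_add_cancel, zero_vadd]
  rw [← e] at h'
  have := h'.of_vadd
  rw [zero_add, add_neg_cancel] at this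
  exact this.rotate.swap_right

include hφ in
lemma shiftedPatch_subset {R R' : ℕ} {ε : Fin d → ℤ} (hε : len ε ≤ 1) (hR : R' + 1 ≤ R) (z : Y) :
    shiftedPatch φ R ε z ⊆ patch φ R' z := by
  intro y hy
  have := (neg_vadd_mem_patch hφ).1 hy
  refine mem_patch.2 fun i hi => this i ?_
  have := len_sub_le i ε
  omega

include hφ in
/-- In dimension at least two, the radius of the patches can be increased. -/
lemma cycMem_patch_succ [Nontrivial (Fin d)] {R₁ R : ℕ} (hsep : ∀ z, IsSeparated d (patch φ R₁ z))
    (hR : R₁ + 1 ≤ R)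
    (h : ∀ z k, CycMem H (patch φ R z) (0 : Fin d → ℤ) (Pi.single k 1) (-Pi.single k 1))
    (z : Y) (k : Fin d) :
    CycMem H (patch φ (R + 1) z) (0 : Fin d → ℤ) (Pi.single k 1) (-Pi.single k 1) := by
  -- The ball of radius R + 1 is the union of the balls of radius R around 0 and the unit vectors.
  -- The shifted balls are imposed one at a time, keeping the cycles in all directions.
  have key : ∀ l : List (Fin d → ℤ), (∀ ε ∈ l, ∃ j, ε = Pi.single j 1 ∨ ε = -Pi.single j 1) →
      ∀ k, CycMem H {y | y ∈ patch φ R z ∧ ∀ ε ∈ l, y ∈ shiftedPatch φ R ε z}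
        (0 : Fin d → ℤ) (Pi.single k 1) (-Pi.single k 1) := by
    intro l
    induction l with
    | nil =>
      intro _ k
      simpa using h z k
    | cons ε l ih =>
      intro hl k
      have ih' := ih fun ε' hε' => hl ε' (List.mem_cons_of_mem _ hε')
      obtain ⟨j, hj⟩ := hl ε List.mem_cons_self
      have hε1 : len ε = 1 := (len_add_self_single hj).1
      have hj' : -ε = Pi.single j 1 ∨ -ε = -Pi.single j 1 := by
        rcases hj with rfl | rfl
        · exact Or.inr rfl
        · exact Or.inl (neg_neg _)
      have := cycMem_inter_direction (hsep z)
        (fun y hy => patch_anti (by omega) z hy.1) (shiftedPatch_subset hφ hε1.le hR z) ih' hj'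
        (cycMem_shiftedPatch hj z fun z => h z j) k
      convert this using 1
      ext y
      simp only [List.mem_cons, forall_eq_or_imp, Set.mem_ofPred_eq, Set.mem_inter_iff]
      tauto
  have hl := key ((Finset.univ.image fun j : Fin d => (Pi.single j 1 : Fin d → ℤ)) ∪
    (Finset.univ.image fun j : Fin d => (-Pi.single j 1 : Fin d → ℤ))).toList (by
      intro ε hε
      simp only [Finset.mem_toList, Finset.mem_union, Finset.mem_image, Finset.mem_univ,
        true_and] at hε
      rcases hε with ⟨j, rfl⟩ | ⟨j, rfl⟩
      · exact ⟨j, Or.inl rfl⟩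
      · exact ⟨j, Or.inr rfl⟩) k
  convert hl using 1
  ext y
  simp only [Finset.mem_toList, Finset.mem_union, Finset.mem_image, Finset.mem_univ,
        true_and, Set.mem_ofPred_eq]
  constructor
  · intro hy
    refine ⟨patch_anti (by omega) z hy, ?_⟩
    have : ∀ ε : Fin d → ℤ, len ε = 1 → y ∈ shiftedPatch φ R ε z := by
      intro ε hε
      refine (neg_vadd_mem_patch hφ).2 fun i hi => mem_patch.1 hy i ?_
      have := len_add_le (i - ε) ε
      rw [sub_add_cancel] at this
      omega
    rintro ε (⟨j, rfl⟩ | ⟨j, rfl⟩)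
    · exact this _ (len_single j 1)
    · exact this _ ((len_neg _).trans (len_single j 1))
  · rintro ⟨hy, hy'⟩
    refine mem_patch.2 fun i hi => ?_
    by_cases hi' : len i ≤ R
    · exact mem_patch.1 hy i hi'
    have hi0 : i ≠ 0 := by
      rintro rfl
      rw [len_zero] at hi'
      omega
    obtain ⟨j, ε, hε, hlen⟩ := exists_len_sub_single hi0
    refine (neg_vadd_mem_patch hφ).1 (hy' ε ?_) i (by omega)
    exact hε.imp (fun h => ⟨j, h.symm⟩) (fun h => ⟨j, h.symm⟩)

/-- The values of a point on the ball of radius `R`. -/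
def values (φ : Y ≃ₜ C.carrier) (R : ℕ) (y : Y) : ball d R → X := fun i => (φ y).1 i

lemma values_eq_iff {R : ℕ} {y z : Y} : values φ R y = values φ R z ↔ y ∈ patch φ R z := by
  rw [mem_patch, funext_iff]
  simp [values, mem_ball]

lemma preimage_values {R : ℕ} {z : Y} : values φ R ⁻¹' {values φ R z} = patch φ R z := by
  ext y
  exact values_eq_iff

lemma isLocallyConstant_values (R : ℕ) : IsLocallyConstant (values φ R) := by
  rw [IsLocallyConstant.iff_eventually_eq]
  intro y
  filter_upwards [(isClopen_patch (φ := φ) R y).2.mem_nhds (self_mem_patch R y)] with z hz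
  exact values_eq_iff.2 hz

lemma cycMem_of_patch [Finite X] {U : Set Y} {a b c : Fin d → ℤ} (hU : IsClopen U)
    (hd : DisjointTranslates U a b c) (R : ℕ)
    (h : ∀ y ∈ U, patch φ R y ⊆ U ∧ CycMem H (patch φ R y) a b c) : CycMem H U a b c := by
  refine CycMem.of_partition (isLocallyConstant_values (φ := φ) R) hU hd fun y hy => ?_
  rw [preimage_values, Set.inter_eq_right.2 (h y hy).1]
  exact (h y hy).2

end Patch

/-! ### Enlarging the radius of patches in dimension one. -/

section DimensionOne

variable {X Y : Type*} [Finite X] [TopologicalSpace X] [DiscreteTopology X]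
  [TopologicalSpace Y] [AddAction (Fin 1 → ℤ) Y] {C : Subshift X (Fin 1 → ℤ)} {φ : Y ≃ₜ C.carrier}
  (hφ : ∀ (g : Fin 1 → ℤ) (y : Y), (φ (g +ᵥ y) : (Fin 1 → ℤ) → X) = translate g (φ y))
  [ContinuousConstVAdd (Fin 1 → ℤ) Y] {H : Subgroup (topFullGroup (Fin 1 → ℤ) Y)}

lemma len_fin_one (a : Fin 1 → ℤ) : len a = (a 0).natAbs := by simp [len]

/-- The value of a point of a one-dimensional subshift at an integer. -/
def valueAt (φ : Y ≃ₜ C.carrier) (y : Y) (n : ℤ) : X := (φ y).1 (fun _ => n)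

lemma mem_patch_fin_one {R : ℕ} {y z : Y} :
    y ∈ patch φ R z ↔ ∀ n : ℤ, n.natAbs ≤ R → valueAt φ y n = valueAt φ z n := by
  rw [mem_patch]
  constructor
  · exact fun h n hn => h _ (by rwa [len_fin_one])
  · intro h i hi
    rw [len_fin_one] at hi
    have e : i = fun _ => i 0 := funext fun k => by rw [Subsingleton.elim k 0]
    rw [e]
    exact h _ hi

include hφ in
lemma valueAt_vadd (g : Fin 1 → ℤ) (y : Y) (n : ℤ) :
    valueAt φ (g +ᵥ y) n = valueAt φ y (n - g 0) := by
  rw [valueAt, apply_vadd hφ, valueAt]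
  exact congrArg (φ y).1 (funext fun k => by rw [Pi.sub_apply, Subsingleton.elim k 0])

include hφ in
lemma mem_shiftedPatch_fin_one {R : ℕ} {ε : Fin 1 → ℤ} {y z : Y} :
    y ∈ shiftedPatch φ R ε z ↔
      ∀ n : ℤ, (n - ε 0).natAbs ≤ R → valueAt φ y n = valueAt φ z n := by
  rw [shiftedPatch, Set.mem_preimage, mem_patch_fin_one]
  simp only [valueAt_vadd hφ, Pi.neg_apply, sub_neg_eq_add]
  constructor
  · intro h n hn
    simpa using h _ hn
  · intro h n hn
    exact h _ (by simpa using hn)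

include hφ in
/-- In dimension one, the radius of the patches can be increased: a patch of larger radius that is
not periodic with period `4` is an intersection of translated patches with commuting supports
elsewhere, and a periodic one is the complement of non-periodic ones in a patch. -/
lemma cycMem_patch_succ_fin_one {R₁ R : ℕ} (hsep : ∀ z, IsSeparated 1 (patch φ R₁ z))
    (hR : R₁ + 2 ≤ R)
    (h : ∀ z, CycMem H (patch φ R z) (0 : Fin 1 → ℤ) (Pi.single 0 1) (-Pi.single 0 1)) (z : Y) :
    CycMem H (patch φ (R + 1) z) (0 : Fin 1 → ℤ) (Pi.single 0 1) (-Pi.single 0 1) := by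
  set e : Fin 1 → ℤ := Pi.single 0 1 with he
  have he0 : e 0 = 1 := by simp [he]
  have he1 : len e = 1 := len_single 0 1
  have nonper : ∀ z : Y, (∃ n : ℤ, n.natAbs ≤ R + 1 ∧ (n + 4).natAbs ≤ R + 1 ∧
      valueAt φ z n ≠ valueAt φ z (n + 4)) → CycMem H (patch φ (R + 1) z) 0 e (-e) := by
    rintro z ⟨n, hn, hn4, hne⟩
    have h1 := cycMem_shiftedPatch (ε := e) (Or.inl rfl) z h
    have h2 := cycMem_shiftedPatch (ε := -e) (Or.inr rfl) z h
    rw [neg_neg] at h2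
    have hP : shiftedPatch φ R e z ⊆ patch φ R₁ z := shiftedPatch_subset hφ he1.le (by omega) z
    have hQ : shiftedPatch φ R (-e) z ⊆ patch φ R₁ z :=
      shiftedPatch_subset hφ ((len_neg e).trans he1).le (by omega) z
    have hV : shiftedPatch φ R e z ∩ shiftedPatch φ R (-e) z = patch φ (R + 1) z := by
      ext y
      rw [Set.mem_inter_iff, mem_shiftedPatch_fin_one hφ, mem_shiftedPatch_fin_one hφ,
        mem_patch_fin_one, Pi.neg_apply, he0]
      constructor
      · rintro ⟨h1, h2⟩ m hm
        by_cases hm' : (m - 1).natAbs ≤ R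
        · exact h1 m hm'
        · exact h2 m (by omega)
      · exact fun h => ⟨fun m hm => h m (by omega), fun m hm => h m (by omega)⟩
    have h3 : CycMem H (shiftedPatch φ R e z ∩ shiftedPatch φ R (-e) z) 0 (-e) e := by
      refine h1.inter h2 fun p hp q hq s hs t ht hst heq => ?_
      have hst' : s = 0 ∨ s = -e ∨ s = -e + -e := hs
      have htt' : t = 0 ∨ t = e ∨ t = e + e := ht
      -- The levels 0, -1, -2 and 0, 1, 2 differ by at most 3 except for the pair -2, 2. A
      -- coincidence there makes `q` the shift of `p` by 4, which contradicts `hne`.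
      by_cases hfour : s = -e + -e ∧ t = e + e
      · have hq4 : ∀ m, valueAt φ q m = valueAt φ p (m + 4) := by
          intro m
          have e1 : q = (-t + s) +ᵥ p := by rw [add_vadd, heq, neg_vadd_vadd]
          rw [e1, valueAt_vadd hφ, hfour.1, hfour.2]
          congr 1
        refine hne ?_
        rw [← (mem_shiftedPatch_fin_one hφ).1 hq n (by rw [Pi.neg_apply, he0]; omega), hq4,
          (mem_shiftedPatch_fin_one hφ).1 hp (n + 4) (by rw [he0]; omega)]
      · have hval : ∀ a b : Fin 1 → ℤ, a 0 ≠ b 0 → a ≠ b := fun a b hab hab' => hab (by rw [hab'])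
        refine (hsep z).vadd_ne ?_ ?_ (hP hp) (hQ hq) heq
        · apply hval
          rcases hst' with rfl | rfl | rfl <;> rcases htt' with rfl | rfl | rfl <;>
            simp_all
        · rw [len_fin_one]
          rcases hst' with rfl | rfl | rfl <;> rcases htt' with rfl | rfl | rfl <;>
            simp_all
    rw [hV] at h3
    exact h3.swap_right
  by_cases hz : ∃ n : ℤ, n.natAbs ≤ R + 1 ∧ (n + 4).natAbs ≤ R + 1 ∧
      valueAt φ z n ≠ valueAt φ z (n + 4)
  · exact nonper z hz
  push Not at hz
  -- For a patch of period 4 the complement in the patch of radius R is used: it consists of patches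
  -- of radius R + 1 that are not of period 4.
  refine (h z).of_sdiff (isClopen_patch _ _) (patch_anti (by omega) z) ?_
  have hZ : patch φ R z \ patch φ (R + 1) z ⊆ patch φ R₁ z :=
    Set.sdiff_subset.trans (patch_anti (by omega) z)
  have hcl : IsClopen (patch φ R z \ patch φ (R + 1) z) :=
    (isClopen_patch _ _).diff (isClopen_patch _ _)
  refine cycMem_of_patch hcl ((hsep z).disjointTranslates hcl hZ 0) (R + 1)
    fun y hy => ⟨?_, nonper y ?_⟩
  · intro x hx
    refine ⟨?_, fun hx' => hy.2 ?_⟩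
    · rw [← patch_eq_of_mem hy.1]
      exact patch_anti (by omega) y hx
    · rw [← patch_eq_of_mem hx', patch_eq_of_mem hx]
      exact self_mem_patch _ _
  · by_contra! hcon
    refine hy.2 (mem_patch_fin_one.2 fun n hn => ?_)
    have hyz := mem_patch_fin_one.1 hy.1
    by_cases hn' : n.natAbs ≤ R
    · exact hyz n hn'
    rcases lt_or_ge n 0 with hneg | hpos
    -- Two patches of period 4 that agree on radius R agree on radius R + 1, as the end values are
    -- copied from distance 4 inside. For n = -(R + 1) the point n + 4 lies in the ball of radius R
    -- because R ≥ 2; this fails for R = 1.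
    · rw [hcon n hn (by omega), hz n hn (by omega), hyz (n + 4) (by omega)]
    · have h1 := hcon (n - 4) (by omega) (by rw [sub_add_cancel]; exact hn)
      have h2 := hz (n - 4) (by omega) (by rw [sub_add_cancel]; exact hn)
      rw [sub_add_cancel] at h1 h2
      rw [← h1, ← h2, hyz (n - 4) (by omega)]

end DimensionOne

/-! ### Germs of three-cycles at a point. -/

section Local

variable {G Y : Type*} [AddCommGroup G] [AddAction G Y] [TopologicalSpace Y]
  [ContinuousConstVAdd G Y]

/-- Near the point `u`, all three-cycles along `a`, `b`, `c` over small clopen sets belong to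
`H`. -/
def LocalCycMem (H : Subgroup (topFullGroup G Y)) (u : Y) (a b c : G) : Prop :=
  (a ≠ b ∧ b ≠ c ∧ a ≠ c) ∧
    ∃ N, IsClopen N ∧ u ∈ N ∧ ∀ V, IsClopen V → V ⊆ N → CycMem H V a b c

variable [CompactSpace Y] [T2Space Y] [TotallyDisconnectedSpace Y]
  {H : Subgroup (topFullGroup G Y)} {u : Y}

lemma exists_separated_nhds (hfree : ∀ (g : G) (y : Y), g +ᵥ y = y → g = 0) (F : Finset G)
    (u : Y) : ∃ N, IsClopen N ∧ u ∈ N ∧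
      ∀ s ∈ F, ∀ t ∈ F, s ≠ t → ∀ p ∈ N, ∀ q ∈ N, s +ᵥ p ≠ t +ᵥ q := by
  have hinj : Function.Injective fun g : F => g.1 +ᵥ u := by
    intro g h hgh
    have h1 : (-h.1 + g.1) +ᵥ u = u := by
      rw [add_vadd]
      exact (congrArg (-h.1 +ᵥ ·) hgh).trans (neg_vadd_vadd _ _)
    have h2 := hfree _ _ h1
    rw [neg_add_eq_zero] at h2
    exact Subtype.ext h2.symm
  obtain ⟨N, huN, hN⟩ := exists_isTower hinj
  refine ⟨N, hN.clopen, huN, fun s hs t ht hst p hp q hq h => hst ?_⟩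
  exact congrArg Subtype.val (hN.index_eq ⟨s, hs⟩ ⟨t, ht⟩ p hp q hq h)

/-- Over a small enough base distinct group elements give disjoint levels, by freeness. The
disjointness conditions of the two rules thus reduce to inequalities in the group, and
`ternary_of_linked` applies. -/
lemma LocalCycMem.of_linked (hfree : ∀ (g : G) (y : Y), g +ᵥ y = y → g = 0) {a b c d e : G}
    (h1 : LocalCycMem H u a b c) (h2 : LocalCycMem H u b d e) (had : a ≠ d) :
    LocalCycMem H u a b d := by
  classical
  refine ternary_of_linked (R := LocalCycMem H u) ?_ ?_ ?_ ?_ h1 h2 had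
  · rintro a b c ⟨⟨h1, h2, h3⟩, N, hN, hu, h⟩
    exact ⟨⟨h2, h3.symm, h1.symm⟩, N, hN, hu, fun V hV hVN => (h V hV hVN).rotate⟩
  · rintro a b c ⟨⟨h1, h2, h3⟩, N, hN, hu, h⟩
    exact ⟨⟨h3, h2.symm, h1⟩, N, hN, hu, fun V hV hVN => (h V hV hVN).swap_right⟩
  · rintro a b c d ⟨⟨h1, h2, h3⟩, N, hN, hu, h⟩ ⟨⟨k1, k2, k3⟩, M, hM, hu', k⟩ hcd
    obtain ⟨L, hL, huL, hsep⟩ := exists_separated_nhds hfree {a, b, c, d} u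
    refine ⟨⟨h3, hcd, k3⟩, N ∩ M ∩ L, (hN.inter hM).inter hL, ⟨⟨hu, hu'⟩, huL⟩,
      fun V hV hVN => ?_⟩
    refine (h V hV fun x hx => (hVN hx).1.1).share_two (k V hV fun x hx => (hVN hx).1.2)
      ⟨hV, fun i j x hx y hy hxy => ?_⟩
    have hmem : ∀ i, (![a, b, c, d] : Fin 4 → G) i ∈ ({a, b, c, d} : Finset G) := by
      intro i
      fin_cases i <;> simp
    have hinj : Function.Injective (![a, b, c, d] : Fin 4 → G) := by
      intro i j hij
      fin_cases i <;> fin_cases j <;> simp at hij ⊢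
      all_goals first
        | exact absurd hij ‹_›
        | exact absurd hij.symm ‹_›
    by_contra hij
    exact hsep _ (hmem i) _ (hmem j) (hinj.ne hij) x (hVN hx).2 y (hVN hy).2 hxy
  · rintro a b c d e ⟨⟨h1, h2, h3⟩, N, hN, hu, h⟩ ⟨⟨k1, k2, k3⟩, M, hM, hu', k⟩ hbd hbe hcd hce
    obtain ⟨L, hL, huL, hsep⟩ := exists_separated_nhds hfree {a, b, c, d, e} u
    refine ⟨⟨h1, hbd, k1⟩, N ∩ M ∩ L, (hN.inter hM).inter hL, ⟨⟨hu, hu'⟩, huL⟩,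
      fun V hV hVN => ?_⟩
    have := (h V hV fun x hx => (hVN hx).1.1).inter (k V hV fun x hx => (hVN hx).1.2) ?_
    · rwa [Set.inter_self] at this
    intro p hp q hq s hs t ht hst
    refine hsep s ?_ t ?_ ?_ p (hVN hp).2 q (hVN hq).2
    · rcases hs with rfl | rfl | rfl <;> simp
    · rcases ht with rfl | rfl | rfl <;> simp
    · rcases hs with rfl | rfl | rfl <;> rcases ht with rfl | rfl | rfl
      · simp at hst
      all_goals first
        | assumption
        | exact Ne.symm ‹_›

lemma alternatingFullGroup_le_of_local
    (h : ∀ (u : Y) (a b c : G), a ≠ b → b ≠ c → a ≠ c → LocalCycMem H u a b c) :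
    alternatingFullGroup G Y ≤ H := by
  rw [alternatingFullGroup, Subgroup.closure_le]
  rintro _ ⟨U, a, b, c, hU, hd, rfl⟩
  have hT := isTower_of_disjointTranslates hU hd
  have e := threeCycle_eq_tower hT (a := 0) (b := 1) (c := 2) (by decide) (by decide) (by decide)
    hU hd
  simp only [Matrix.cons_val] at e
  rw [e]
  refine tower_mem_of_local hT _ H fun u hu => ?_
  have ne : ∀ i j, i ≠ j → (![a, b, c] : Fin 3 → G) i ≠ ![a, b, c] j := by
    intro i j hij h
    exact hij (hT.index_eq i j u hu u hu (by rw [h]))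
  obtain ⟨-, N, hN, huN, h⟩ := h u a b c (ne 0 1 (by decide)) (ne 1 2 (by decide))
    (ne 0 2 (by decide))
  refine ⟨N, hN, huN, fun V hV hVN _ => ?_⟩
  exact (cycMem_iff_tower hV (i := 0) (j := 1) (k := 2) (by decide) (by decide)
    (by decide)).1 (h V hV.clopen hVN)

end Local

/-! ### From coordinate directions to all three-cycles. -/

section Generation

variable {d : ℕ} {Y : Type*} [AddAction (Fin d → ℤ) Y] [TopologicalSpace Y]
  [ContinuousConstVAdd (Fin d → ℤ) Y] [CompactSpace Y] [T2Space Y] [TotallyDisconnectedSpace Y]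
  {H : Subgroup (topFullGroup (Fin d → ℤ) Y)}

lemma exists_disjointTranslates_single_nhds
    (hfree : ∀ (g : Fin d → ℤ) (y : Y), g +ᵥ y = y → g = 0) (u : Y) (k : Fin d) :
    ∃ N, IsClopen N ∧ u ∈ N ∧ ∀ V ⊆ N,
      DisjointTranslates V (0 : Fin d → ℤ) (Pi.single k 1) (-Pi.single k 1) := by
  classical
  obtain ⟨N, hN, hu, hsep⟩ := exists_separated_nhds hfree
    {(0 : Fin d → ℤ), Pi.single k 1, -Pi.single k 1} u
  have key : ∀ V ⊆ N, ∀ s ∈ ({(0 : Fin d → ℤ), Pi.single k 1, -Pi.single k 1} : Finset (Fin d → ℤ)),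
      ∀ t ∈ ({(0 : Fin d → ℤ), Pi.single k 1, -Pi.single k 1} : Finset (Fin d → ℤ)), s ≠ t →
      Disjoint (s +ᵥ V) (t +ᵥ V) := by
    intro V hV s hs t ht hst
    rw [Set.disjoint_left]
    rintro _ ⟨p, hp, rfl⟩ ⟨q, hq, h⟩
    exact hsep s hs t ht hst p (hV hp) q (hV hq) h.symm
  exact ⟨N, hN, hu, fun V hV => ⟨key V hV _ (by simp) _ (by simp) (single_one_ne_zero k).symm,
    key V hV _ (by simp) _ (by simp) (single_one_ne_neg k),
    key V hV _ (by simp) _ (by simp) (by simp)⟩⟩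

/-- The three-cycles along the coordinate directions generate all three-cycles. -/
lemma alternatingFullGroup_le_of_cycMem_single
    (hfree : ∀ (g : Fin d → ℤ) (y : Y), g +ᵥ y = y → g = 0)
    (h : ∀ (V : Set Y) (k : Fin d), IsClopen V →
      DisjointTranslates V (0 : Fin d → ℤ) (Pi.single k 1) (-Pi.single k 1) →
      CycMem H V (0 : Fin d → ℤ) (Pi.single k 1) (-Pi.single k 1)) :
    alternatingFullGroup (Fin d → ℤ) Y ≤ H := by
  refine alternatingFullGroup_le_of_local fun u a b c hab hbc hac => ?_
  have base : ∀ x k, LocalCycMem H u x (Pi.single k 1 + x) (-Pi.single k 1 + x) := by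
    intro x k
    refine ⟨⟨by simp, by simpa using single_one_ne_neg k, by simp⟩, ?_⟩
    obtain ⟨N, hN, huN, hd⟩ := exists_disjointTranslates_single_nhds hfree (x +ᵥ u) k
    refine ⟨(x +ᵥ ·) ⁻¹' N, hN.preimage (continuous_const_vadd x), huN, fun V hV hVN => ?_⟩
    have := (h (x +ᵥ V) k (isClopen_translate hV x) (hd _ ?_)).of_vadd
    · rwa [zero_add] at this
    · rintro _ ⟨v, hv, rfl⟩
      exact hVN hv
  have sub : ∀ g : Fin d → ℤ, ∀ x, g ≠ 0 → ∃ e, LocalCycMem H u x (g + x) e := by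
    -- The differences of pairs that extend to a local three-cycle form a subgroup: triples through
    -- (x, g' + x) and (g' + x, g + g' + x) are linked at g' + x. It contains the standard basis,
    -- hence everything.
    let K : AddSubgroup (Fin d → ℤ) :=
      { carrier := {g | ∀ x, g ≠ 0 → ∃ e, LocalCycMem H u x (g + x) e}
        zero_mem' := fun x hx => absurd rfl hx
        add_mem' := by
          intro g g' hg hg' x hne
          by_cases hg0 : g' = 0
          · subst hg0
            obtain ⟨e, he⟩ := hg x (by simpa using hne)
            exact ⟨e, by simpa using he⟩
          by_cases hg1 : g = 0
          · subst hg1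
            obtain ⟨e, he⟩ := hg' x hg0
            exact ⟨e, by simpa using he⟩
          obtain ⟨e, he⟩ := hg' x hg0
          obtain ⟨f, hf⟩ := hg (g' + x) hg1
          have := he.of_linked hfree hf (by rw [← add_assoc]; simpa using hne)
          obtain ⟨⟨h1, h2, h3⟩, N, hN, hu, hN'⟩ := this
          rw [← add_assoc] at h2 h3 hN'
          exact ⟨g' + x, ⟨h3, h2.symm, h1⟩, N, hN, hu, fun V hV hVN => (hN' V hV hVN).swap_right⟩
        neg_mem' := by
          intro g hg x hne
          obtain ⟨e, ⟨h1, h2, h3⟩, N, hN, hu, hN'⟩ := hg (-g + x) (by simpa using hne)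
          rw [add_neg_cancel_left] at h1 h2 hN'
          exact ⟨e, ⟨h1.symm, h3, h2⟩, N, hN, hu,
            fun V hV hVN => (hN' V hV hVN).rotate.swap_right.rotate.swap_right.rotate.swap_right⟩ }
    have hK : ∀ k, (Pi.single k 1 : Fin d → ℤ) ∈ K := fun k x _ => ⟨_, base x k⟩
    intro g
    have : g ∈ K := by
      rw [← Finset.univ_sum_single g]
      refine sum_mem fun k _ => ?_
      have e : (Pi.single k (g k) : Fin d → ℤ) = g k • Pi.single k 1 := by
        rw [← Pi.single_smul]
        simp
      rw [e]
      exact K.zsmul_mem (hK k) _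
    exact this
  obtain ⟨e, he⟩ := sub (b - a) a (sub_ne_zero.2 hab.symm)
  obtain ⟨f, hf⟩ := sub (c - b) b (sub_ne_zero.2 hbc.symm)
  rw [sub_add_cancel] at he hf
  exact he.of_linked hfree hf hac

end Generation

/-! ### Assembly. -/

section Main

variable {d : ℕ} {X Y : Type*} [Finite X] [TopologicalSpace X] [DiscreteTopology X]
  [TopologicalSpace Y] [AddAction (Fin d → ℤ) Y] [ContinuousConstVAdd (Fin d → ℤ) Y]
  [CompactSpace Y] [T2Space Y] [TotallyDisconnectedSpace Y]
  {C : Subshift X (Fin d → ℤ)} {φ : Y ≃ₜ C.carrier}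

/-- The fixed points of `g` form a closed set, invariant because the group is abelian. If it
contains one orbit, which is dense, then `g` acts trivially. -/
lemma free_of_minimal_of_faithful [AddAction.IsMinimal (Fin d → ℤ) Y]
    [FaithfulVAdd (Fin d → ℤ) Y] (g : Fin d → ℤ) (y : Y) (h : g +ᵥ y = y) : g = 0 := by
  refine FaithfulVAdd.eq_of_vadd_eq_vadd (P := Y) fun z => ?_
  rw [zero_vadd]
  have hcl : IsClosed {z : Y | g +ᵥ z = z} := isClosed_eq (continuous_const_vadd g) continuous_id
  have hd : Dense {z : Y | g +ᵥ z = z} := by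
    refine (AddAction.dense_orbit (Fin d → ℤ) y).mono ?_
    rintro _ ⟨k, rfl⟩
    change g +ᵥ (k +ᵥ y) = k +ᵥ y
    rw [vadd_vadd, add_comm, add_vadd, h]
  have : z ∈ closure {z : Y | g +ᵥ z = z} := hd z
  rwa [hcl.closure_eq] at this

lemma dimension_pos [AddAction.IsMinimal (Fin d → ℤ) Y] [Infinite Y] : d ≠ 0 := by
  rintro rfl
  obtain ⟨y, z, hyz⟩ := exists_pair_ne Y
  obtain ⟨g, hg⟩ := (isOpen_compl_singleton (x := y)).exists_vadd_mem (Fin 0 → ℤ) y ⟨z, hyz.symm⟩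
  rw [Subsingleton.elim g 0, zero_vadd] at hg
  exact hg rfl

lemma cycMem_patch_of_mem_cycleSet
    (hφ : ∀ (g : Fin d → ℤ) (y : Y), (φ (g +ᵥ y) : (Fin d → ℤ) → X) = translate g (φ y))
    (hd0 : d ≠ 0) {R₁ R : ℕ} (hsep : ∀ z, IsSeparated d (patch φ R₁ z)) (hR : R₁ + 2 ≤ R) (z : Y)
    (k : Fin d) :
    CycMem (Subgroup.closure (cycleSet φ (R₁ + 2))) (patch φ R z) (0 : Fin d → ℤ)
      (Pi.single k 1) (-Pi.single k 1) := by
  induction R, hR using Nat.le_induction generalizing z k with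
  | base =>
    have hd := (hsep z).disjointTranslates (isClopen_patch (R₁ + 2) z)
      (patch_anti (by omega) z) k
    exact ⟨isClopen_patch _ _, hd, Subgroup.subset_closure ⟨φ z, (φ z).2, k, hd, rfl⟩⟩
  | succ R hR ih =>
    by_cases hd1 : d = 1
    · subst hd1
      rw [Subsingleton.elim k 0]
      exact cycMem_patch_succ_fin_one hφ hsep hR (fun z => ih z 0) z
    · have : Nontrivial (Fin d) := Fin.nontrivial_iff_two_le.2 (by omega)
      exact cycMem_patch_succ hφ hsep (by omega) ih z k

lemma closure_cycleSet [AddAction.IsMinimal (Fin d → ℤ) Y] [Infinite Y]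
    (hfree : ∀ (g : Fin d → ℤ) (y : Y), g +ᵥ y = y → g = 0)
    (hφ : ∀ (g : Fin d → ℤ) (y : Y), (φ (g +ᵥ y) : (Fin d → ℤ) → X) = translate g (φ y))
    {R₁ : ℕ} (hsep : ∀ z, IsSeparated d (patch φ R₁ z)) :
    Subgroup.closure (cycleSet φ (R₁ + 2)) = commutator (topFullGroup (Fin d → ℤ) Y) := by
  refine le_antisymm ?_ ((commutator_le_alternatingFullGroup hfree).trans ?_)
  · refine le_trans ?_ alternatingFullGroup_le_commutator
    rw [Subgroup.closure_le]
    rintro _ ⟨w, hw, i, h, rfl⟩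
    exact Subgroup.subset_closure ⟨_, _, _, _, _, h, rfl⟩
  · refine alternatingFullGroup_le_of_cycMem_single hfree fun V k hV hd => ?_
    -- A clopen set is a finite disjoint union of patches of one radius, which is increased here to
    -- be at least R₁ + 2.
    obtain ⟨R, hR⟩ := exists_radius_subset φ hV
    refine cycMem_of_patch (φ := φ) hV hd (R + (R₁ + 2)) fun y hy => ?_
    exact ⟨(patch_anti (by omega) y).trans (hR y hy),
      cycMem_patch_of_mem_cycleSet hφ (dimension_pos (Y := Y)) hsep (by omega) y k⟩

end Main

end TopFull

theorem theorem1 {d : ℕ} {X Y : Type*}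
    [Finite X] [TopologicalSpace X] [DiscreteTopology X]
    [TopologicalSpace Y] (hY : Nonempty (Y ≃ₜ cantorSet))
    [AddAction (Fin d → ℤ) Y] [ContinuousConstVAdd (Fin d → ℤ) Y]
    [AddAction.IsMinimal (Fin d → ℤ) Y] [FaithfulVAdd (Fin d → ℤ) Y]
    (C : SymbolicDynamics.FullShift.Subshift X (Fin d → ℤ)) (φ : Y ≃ₜ C.carrier)
    (hφ : ∀ (g : Fin d → ℤ) (y : Y),
      (φ (g +ᵥ y) : (Fin d → ℤ) → X) = TopFull.translate g (φ y)) :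
    Group.FG (commutator (TopFull.topFullGroup (Fin d → ℤ) Y)) ∧
    (∃ R₁ : ℕ, TopFull.IsSeparatingRadius C R₁) ∧
    ∀ R₁ : ℕ, TopFull.IsSeparatingRadius C R₁ →
      (∀ w ∈ C.carrier, ∀ i : Fin d,
        TopFull.DisjointTranslates (TopFull.patchSet φ (TopFull.ball d (R₁ + 2)) w)
          (0 : Fin d → ℤ) (Pi.single i 1) (-Pi.single i 1)) ∧
      (TopFull.cycleSet φ (R₁ + 2)).Finite ∧
      Subgroup.closure (TopFull.cycleSet φ (R₁ + 2)) =
        commutator (TopFull.topFullGroup (Fin d → ℤ) Y) := by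
  obtain ⟨ψ⟩ := hY
  have : CompactSpace cantorSet := isCompact_iff_compactSpace.1 isCompact_cantorSet
  have : CompactSpace Y := ψ.symm.compactSpace
  have : T2Space Y := ψ.symm.t2Space
  have : TotallyDisconnectedSpace Y := φ.symm.totallyDisconnectedSpace
  have : Infinite Y := (ψ.toEquiv.trans cantorSetEquivNatToBool).infinite_iff.2 inferInstance
  have hfree := TopFull.free_of_minimal_of_faithful (d := d) (Y := Y)
  have hex := TopFull.exists_isSeparatingRadius hφ hfree
  have main : ∀ R₁ : ℕ, TopFull.IsSeparatingRadius C R₁ →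
      (∀ w ∈ C.carrier, ∀ i : Fin d,
        TopFull.DisjointTranslates (TopFull.patchSet φ (TopFull.ball d (R₁ + 2)) w)
          (0 : Fin d → ℤ) (Pi.single i 1) (-Pi.single i 1)) ∧
      (TopFull.cycleSet φ (R₁ + 2)).Finite ∧
      Subgroup.closure (TopFull.cycleSet φ (R₁ + 2)) =
        commutator (TopFull.topFullGroup (Fin d → ℤ) Y) := by
    intro R₁ hR₁
    have hsep : ∀ z, TopFull.IsSeparated d (TopFull.patch φ R₁ z) := fun z g hg hlen y =>
      (TopFull.isSeparatingRadius_iff hφ).1 hR₁ z y g hg hlen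
    refine ⟨fun w hw i => ?_, TopFull.finite_cycleSet _, TopFull.closure_cycleSet hfree hφ hsep⟩
    obtain ⟨z, hz⟩ := φ.surjective ⟨w, hw⟩
    obtain rfl : (φ z).1 = w := by rw [hz]
    exact (hsep z).disjointTranslates (TopFull.isClopen_patch _ _)
      (TopFull.patch_anti (by omega) z) i
  refine ⟨?_, hex, main⟩
  obtain ⟨R₁, hR₁⟩ := hex
  obtain ⟨-, hfin, hgen⟩ := main R₁ hR₁
  rw [Group.fg_iff_subgroup_fg, Subgroup.fg_iff]
  exact ⟨_, hgen, hfin⟩
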